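/- Let $n\ge 1$, let $g=g_{ij}(x^k)\,dx^i dx^j$ be a smooth pseudo-Riemannian metric (of any signature) on a connected open coordinate domain $U\subseteq\mathbb R^n$ (the "$n$-space"), let $I\subseteq\mathbb R$ be a non-empty open interval and $\varepsilon\neq 0$ a real constant (for instance $\varepsilon=\pm1$). Consider the $(n+1)$-dimensional decomposable space $I\times U$ with metric $$ds^2=\varepsilon\,dt^2+g_{ij}(x^k)\,dx^i dx^j .$$ All vector fields and functions are smooth and $\Gamma$ is the Levi-Civita connection of the metric in question. A vector field $X$ is a Killing vector (KV) if $\mathcal L_Xg=0$; a homothetic Killing vector (HKV) if $\mathcal L_Xg=2\psi g$ with a constant $\psi\ne0$; an affine collineation if $\mathcal L_X\Gamma=0$; a projective collineation (PC) if $\mathcal L_X\Gamma^i_{jk}=\omega_j\delta^i_k+\omega_k\delta^i_j$ for a one-form $\omega$; a special PC if this holds with $\omega_i=\phi_{,i}$ and $\phi_{;ij}=0$; a proper PC if it is a PC but not an affine collineation, HKV or KV. A vector field $X$ is gradient if $X_i=S_{,i}$ for some function $S$. A rotation among the axes $t$ and $x^i$ is a KV of the decomposable space of the form $\xi\,\partial_t+\eta\,\partial_i$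 with $\partial_t\eta\not\equiv0$. Then: (A) Every proper PC of the decomposable space is a special PC. (B) The decomposable space admits an HKV if and only if the $n$-space admits an HKV. (C) If the $n$-space admits a gradient HKV, then the decomposable space admits a proper PC. The converse holds provided that no non-zero gradient KV of the $n$-space is orthogonal to all gradient KVs of the $n$-space; this proviso is automatically satisfied when $g$ is definite. In particular, if $g$ is a Riemannian (positive definite) metric, the decomposable space admits a proper PC if and only if the $n$-space admits a gradient HKV. (D) For each $i$, a rotation among the axes $t$ and $x^i$ exists if and only if the $n$-space admits a non-zero gradient KV of the form $\lambda\,\partial_i$. (E) The projective algebra of the decomposable space (the real vector space of its PCs) has dimension at least $2$; if its dimension equals $2$, then the $n$-space admits no non-zero special PC (in particular no non-zero KV, HKV or affine collineation). -/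

import Mathlib

open scoped ContDiff

noncomputable section

namespace DecomposableSpace

/-- The partial derivative of `f` in the `j`-th coordinate direction at `x`. -/
def pd {m : ℕ} (f : (Fin m → ℝ) → ℝ) (j : Fin m) (x : Fin m → ℝ) : ℝ :=
  fderiv ℝ f x (Pi.single j 1)

/-- `g` is the component matrix of a smooth pseudo-Riemannian metric (of any signature) on the
coordinate domain `U`. -/
structure IsMetricOn {m : ℕ} (U : Set (Fin m → ℝ))
    (g : (Fin m → ℝ) → Matrix (Fin m) (Fin m) ℝ) : Prop where
  smooth : ∀ i j, ContDiffOn ℝ ∞ (fun x => g x i j) U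
  symm : ∀ x ∈ U, (g x).IsSymm
  nondeg : ∀ x ∈ U, (g x).det ≠ 0

/-- The components `Γ^i_{jk}` of the Levi-Civita connection of `g`. -/
def christoffel {m : ℕ} (g : (Fin m → ℝ) → Matrix (Fin m) (Fin m) ℝ)
    (i j k : Fin m) (x : Fin m → ℝ) : ℝ :=
  (1 / 2) * ∑ l, (g x)⁻¹ i l *
    (pd (fun y => g y l k) j x + pd (fun y => g y l j) k x - pd (fun y => g y j k) l x)

/-- The components `(L_X g)_{ij}` of the Lie derivative of the metric. -/
def lieMetric {m : ℕ} (g : (Fin m → ℝ) → Matrix (Fin m) (Fin m) ℝ)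
    (X : (Fin m → ℝ) → Fin m → ℝ) (i j : Fin m) (x : Fin m → ℝ) : ℝ :=
  ∑ k, (X x k * pd (fun y => g y i j) k x
    + g x k j * pd (fun y => X y k) i x + g x i k * pd (fun y => X y k) j x)

/-- The components `(L_X Γ)^i_{jk}` of the Lie derivative of the Levi-Civita connection. -/
def lieConnection {m : ℕ} (g : (Fin m → ℝ) → Matrix (Fin m) (Fin m) ℝ)
    (X : (Fin m → ℝ) → Fin m → ℝ) (i j k : Fin m) (x : Fin m → ℝ) : ℝ :=
  pd (fun y => pd (fun z => X z i) j y) k x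
    + ∑ r, (X x r * pd (fun y => christoffel g i j k y) r x
      - pd (fun y => X y i) r x * christoffel g r j k x
      + pd (fun y => X y r) j x * christoffel g i r k x
      + pd (fun y => X y r) k x * christoffel g i j r x)

/-- The components `φ_{;ij}` of the second covariant derivative of a function. -/
def hessian {m : ℕ} (g : (Fin m → ℝ) → Matrix (Fin m) (Fin m) ℝ)
    (φ : (Fin m → ℝ) → ℝ) (i j : Fin m) (x : Fin m → ℝ) : ℝ :=
  pd (fun y => pd φ i y) j x - ∑ k, christoffel g k i j x * pd φ k x

/-- Smooth vector fields on `U`. -/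
def IsVectorField {m : ℕ} (U : Set (Fin m → ℝ)) (X : (Fin m → ℝ) → Fin m → ℝ) : Prop :=
  ∀ i, ContDiffOn ℝ ∞ (fun x => X x i) U

/-- Killing vectors: `L_X g = 0`. -/
def IsKilling {m : ℕ} (U : Set (Fin m → ℝ)) (g : (Fin m → ℝ) → Matrix (Fin m) (Fin m) ℝ)
    (X : (Fin m → ℝ) → Fin m → ℝ) : Prop :=
  IsVectorField U X ∧ ∀ x ∈ U, ∀ i j, lieMetric g X i j x = 0

/-- (Proper) homothetic Killing vectors: `L_X g = 2 ψ g` with a constant `ψ ≠ 0`. -/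
def IsHomothetic {m : ℕ} (U : Set (Fin m → ℝ)) (g : (Fin m → ℝ) → Matrix (Fin m) (Fin m) ℝ)
    (X : (Fin m → ℝ) → Fin m → ℝ) : Prop :=
  IsVectorField U X ∧ ∃ ψ : ℝ, ψ ≠ 0 ∧ ∀ x ∈ U, ∀ i j, lieMetric g X i j x = 2 * ψ * g x i j

/-- `X` is a gradient: `g_{ij} X^j = S_{,i}` for a smooth function `S`. -/
def IsGradient {m : ℕ} (U : Set (Fin m → ℝ)) (g : (Fin m → ℝ) → Matrix (Fin m) (Fin m) ℝ)
    (X : (Fin m → ℝ) → Fin m → ℝ) : Prop :=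
  ∃ S : (Fin m → ℝ) → ℝ, ContDiffOn ℝ ∞ S U ∧ ∀ x ∈ U, ∀ i, ∑ j, g x i j * X x j = pd S i x

/-- The vector space of gradient Killing vectors is non-degenerate with respect to `g`: no non-zero
gradient Killing vector is orthogonal to all gradient Killing vectors. A vector of that kind
would be orthogonal to itself, so the condition always holds for a definite metric. -/
def NondegGradientKilling {m : ℕ} (U : Set (Fin m → ℝ))
    (g : (Fin m → ℝ) → Matrix (Fin m) (Fin m) ℝ) : Prop :=
  ∀ Y, IsKilling U g Y → IsGradient U g Y →
    (∀ Z, IsKilling U g Z → IsGradient U g Z →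
      ∀ x ∈ U, ∑ i, ∑ j, g x i j * Y x i * Z x j = 0) →
    ∀ x ∈ U, Y x = 0

/-- Affine collineations: `L_X Γ = 0`. -/
def IsAffine {m : ℕ} (U : Set (Fin m → ℝ)) (g : (Fin m → ℝ) → Matrix (Fin m) (Fin m) ℝ)
    (X : (Fin m → ℝ) → Fin m → ℝ) : Prop :=
  IsVectorField U X ∧ ∀ x ∈ U, ∀ i j k, lieConnection g X i j k x = 0

/-- Projective collineations: `L_X Γ^i_{jk} = w_j δ^i_k + w_k δ^i_j` for a one-form `w`. -/
def IsProjective {m : ℕ} (U : Set (Fin m → ℝ)) (g : (Fin m → ℝ) → Matrix (Fin m) (Fin m) ℝ)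
    (X : (Fin m → ℝ) → Fin m → ℝ) : Prop :=
  IsVectorField U X ∧ ∃ w : (Fin m → ℝ) → Fin m → ℝ,
    (∀ i, ContDiffOn ℝ ∞ (fun x => w x i) U) ∧
    ∀ x ∈ U, ∀ i j k, lieConnection g X i j k x
      = (if i = k then w x j else 0) + (if i = j then w x k else 0)

/-- Special projective collineations: `L_X Γ^i_{jk} = φ_{,j} δ^i_k + φ_{,k} δ^i_j` with a projective
function `φ` such that `φ_{;ij} = 0`. -/
def IsSpecialProjective {m : ℕ} (U : Set (Fin m → ℝ))
    (g : (Fin m → ℝ) → Matrix (Fin m) (Fin m) ℝ) (X : (Fin m → ℝ) → Fin m → ℝ) : Prop :=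
  IsVectorField U X ∧ ∃ φ : (Fin m → ℝ) → ℝ, ContDiffOn ℝ ∞ φ U ∧
    (∀ x ∈ U, ∀ i j k, lieConnection g X i j k x
      = (if i = k then pd φ j x else 0) + (if i = j then pd φ k x else 0)) ∧
    ∀ x ∈ U, ∀ i j, hessian g φ i j x = 0

/-- Proper projective collineations: those that are neither affine collineations nor homothetic
nor Killing vectors. -/
def IsProperProjective {m : ℕ} (U : Set (Fin m → ℝ))
    (g : (Fin m → ℝ) → Matrix (Fin m) (Fin m) ℝ) (X : (Fin m → ℝ) → Fin m → ℝ) : Prop :=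
  IsProjective U g X ∧ ¬ IsAffine U g X ∧ ¬ IsHomothetic U g X ∧ ¬ IsKilling U g X

/-- The coordinate domain `I × U` of the decomposable space; the coordinate `0` is `t`, the
coordinate `i.succ` is `x^i`. -/
def productDomain {n : ℕ} (I : Set ℝ) (U : Set (Fin n → ℝ)) : Set (Fin (n + 1) → ℝ) :=
  {p | p 0 ∈ I ∧ (fun i : Fin n => p i.succ) ∈ U}

/-- The metric `ε dt² + g_{ij} dx^i dx^j`. -/
def productMetric {n : ℕ} (ε : ℝ) (g : (Fin n → ℝ) → Matrix (Fin n) (Fin n) ℝ)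
    (p : Fin (n + 1) → ℝ) : Matrix (Fin (n + 1)) (Fin (n + 1)) ℝ :=
  Matrix.of fun a b =>
    Fin.cases (motive := fun _ => ℝ)
      (Fin.cases (motive := fun _ => ℝ) ε (fun _ => 0) b)
      (fun i => Fin.cases (motive := fun _ => ℝ) 0
        (fun j => g (fun k : Fin n => p k.succ) i j) b) a

/-- `X` is a rotation among the axes `t` and `x^i` of the decomposable space: a Killing vector
`ξ ∂_t + η ∂_i` that mixes the two directions, that is, whose component `η` depends on `t`. (By the
Killing equations this means that `ξ` is not constant; it excludes `c ∂_t` plus a Killing vector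
`η(x) ∂_i` of the `n`-space. The model is `x ∂_t - ε t ∂_x` for `ε dt² + dx²`.) -/
def IsRotation {n : ℕ} (I : Set ℝ) (U : Set (Fin n → ℝ)) (ε : ℝ)
    (g : (Fin n → ℝ) → Matrix (Fin n) (Fin n) ℝ) (i : Fin n)
    (X : (Fin (n + 1) → ℝ) → Fin (n + 1) → ℝ) : Prop :=
  IsKilling (productDomain I U) (productMetric ε g) X ∧
    (∀ p ∈ productDomain I U, ∀ j : Fin n, j ≠ i → X p j.succ = 0) ∧
    ∃ p ∈ productDomain I U, pd (fun q => X q i.succ) 0 p ≠ 0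

theorem isOpen_productDomain {n : ℕ} {I : Set ℝ} {U : Set (Fin n → ℝ)} (hI : IsOpen I)
    (hU : IsOpen U) : IsOpen (productDomain I U) :=
  (hI.preimage (continuous_apply 0)).inter
    (hU.preimage (continuous_pi fun i : Fin n => continuous_apply i.succ))

theorem pd_smooth {m : ℕ} {U : Set (Fin m → ℝ)} (hU : IsOpen U) {f : (Fin m → ℝ) → ℝ}
    (hf : ContDiffOn ℝ ∞ f U) (j : Fin m) : ContDiffOn ℝ ∞ (pd f j) U :=
  (hf.fderiv_of_isOpen hU (m := ∞) (by simp)).clm_apply contDiffOn_const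

theorem pd_combo {m : ℕ} {U : Set (Fin m → ℝ)} (hU : IsOpen U) {f h : (Fin m → ℝ) → ℝ}
    (hf : ContDiffOn ℝ ∞ f U) (hh : ContDiffOn ℝ ∞ h U) (c : ℝ) (j : Fin m) {x : Fin m → ℝ}
    (hx : x ∈ U) : pd (fun y => c * f y + h y) j x = c * pd f j x + pd h j x := by
  have h1 : DifferentiableAt ℝ f x :=
    (hf.contDiffAt (hU.mem_nhds hx)).differentiableAt (by simp)
  have h2 : DifferentiableAt ℝ h x :=
    (hh.contDiffAt (hU.mem_nhds hx)).differentiableAt (by simp)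
  unfold pd
  rw [fderiv_fun_add (h1.const_mul c) h2, fderiv_const_mul h1]
  simp

theorem pd_congr {m : ℕ} {U : Set (Fin m → ℝ)} (hU : IsOpen U) {f h : (Fin m → ℝ) → ℝ}
    (hfh : ∀ x ∈ U, f x = h x) (j : Fin m) {x : Fin m → ℝ} (hx : x ∈ U) :
    pd f j x = pd h j x := by
  unfold pd
  rw [Filter.EventuallyEq.fderiv_eq (Filter.eventuallyEq_of_mem (hU.mem_nhds hx) hfh)]

theorem lieConnection_combo {m : ℕ} {U : Set (Fin m → ℝ)} (hU : IsOpen U)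
    (g : (Fin m → ℝ) → Matrix (Fin m) (Fin m) ℝ) {X Y : (Fin m → ℝ) → Fin m → ℝ}
    (hX : IsVectorField U X) (hY : IsVectorField U Y) (c : ℝ) (i j k : Fin m) {x : Fin m → ℝ}
    (hx : x ∈ U) :
    lieConnection g (c • X + Y) i j k x
      = c * lieConnection g X i j k x + lieConnection g Y i j k x := by
  have h1 : ∀ a b, ∀ y ∈ U, pd (fun z => (c • X + Y) z a) b y
      = c * pd (fun z => X z a) b y + pd (fun z => Y z a) b y := fun a b y hy =>
    pd_combo hU (hX a) (hY a) c b hy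
  have h2 : pd (fun y => pd (fun z => (c • X + Y) z i) j y) k x
      = c * pd (fun y => pd (fun z => X z i) j y) k x
        + pd (fun y => pd (fun z => Y z i) j y) k x := by
    rw [pd_congr hU (h1 i j) k hx]
    exact pd_combo hU (pd_smooth hU (hX i) j) (pd_smooth hU (hY i) j) c k hx
  unfold lieConnection
  rw [h2, mul_add, Finset.mul_sum, add_add_add_comm, ← Finset.sum_add_distrib]
  congr 1
  refine Finset.sum_congr rfl fun r _ => ?_
  rw [h1 i r x hx, h1 r j x hx, h1 r k x hx]
  simp only [Pi.add_apply, Pi.smul_apply, smul_eq_mul]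
  ring

theorem isProjective_combo {m : ℕ} {U : Set (Fin m → ℝ)} (hU : IsOpen U)
    (g : (Fin m → ℝ) → Matrix (Fin m) (Fin m) ℝ) {X Y : (Fin m → ℝ) → Fin m → ℝ}
    (hX : IsProjective U g X) (hY : IsProjective U g Y) (c : ℝ) :
    IsProjective U g (c • X + Y) := by
  obtain ⟨hX, w, hw, h⟩ := hX
  obtain ⟨hY, θ, hθ, h'⟩ := hY
  refine ⟨fun i => ((contDiffOn_const (c := c)).mul (hX i)).add (hY i), c • w + θ,
    fun i => ((contDiffOn_const (c := c)).mul (hw i)).add (hθ i), fun x hx i j k => ?_⟩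
  rw [lieConnection_combo hU g hX hY c i j k hx, h x hx, h' x hx]
  simp only [Pi.add_apply, Pi.smul_apply, smul_eq_mul]
  split_ifs <;> ring

theorem isProjective_zero {m : ℕ} (U : Set (Fin m → ℝ))
    (g : (Fin m → ℝ) → Matrix (Fin m) (Fin m) ℝ) : IsProjective U g 0 := by
  refine ⟨fun i => contDiffOn_const, 0, fun i => contDiffOn_const, fun x _ i j k => ?_⟩
  simp [lieConnection, pd]

/-- The projective algebra of the space with metric `g` on the open domain `U`, as a real vector
space of vector fields. A vector field on `U` is represented by its extension by zero to the whole
coordinate space, so that fields which agree on `U` are equal. -/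
def projectiveAlgebra {m : ℕ} (U : Set (Fin m → ℝ)) (hU : IsOpen U)
    (g : (Fin m → ℝ) → Matrix (Fin m) (Fin m) ℝ) :
    Submodule ℝ ((Fin m → ℝ) → Fin m → ℝ) where
  carrier := {X | IsProjective U g X ∧ ∀ x, x ∉ U → X x = 0}
  add_mem' := by
    rintro X Y ⟨hX, hX0⟩ ⟨hY, hY0⟩
    refine ⟨?_, fun x hx => by simp [hX0 x hx, hY0 x hx]⟩
    have := isProjective_combo hU g hX hY 1
    rwa [one_smul] at this
  zero_mem' := ⟨isProjective_zero U g, fun _ _ => rfl⟩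
  smul_mem' := by
    rintro c X ⟨hX, hX0⟩
    refine ⟨?_, fun x hx => by simp [hX0 x hx]⟩
    have := isProjective_combo hU g hX (isProjective_zero U g) c
    rwa [add_zero] at this

end DecomposableSpace

end

/-! Write a projective collineation of the product as `X = ξ ∂_t + X^i ∂_i`, with one-form `w`. All
Christoffel symbols of the product with an index `t` vanish and the others are those of `g`,
independent of `t`. The projective equation therefore splits into `∂_t² ξ = 2 w_0`, `∂_j ∂_t ξ =
w_j`, `ξ_{;ij} = 0`, `∂_t² X^i = 0`, `(∂_t X^i)_{;j} = w_0 δ^i_j`, and the statement that each slice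
`X^i(t, ·)` is projective for `g` with one-form `w_j`.

The pivot is that `w_0` is a constant `c` (`exists_const`). Since `∂_t X` is again projective, with
one-form `∂_t w`, the fifth equation for it gives `∂_t w_0 = 0`. The slice of `∂_t X` is concircular
with factor `w_0` and projective with one-form `2 d w_0`; comparing with the derivative of `L_X g`
and taking a trace gives `(n + 2) d w_0 = 0` on the slice. Then `φ = ∂_t ξ - c t` has `dφ = w` and
zero Hessian, which is (A).

For (C), a gradient homothetic `Y` with factor `ψ` yields `ψ t² ∂_t + t Y`, with one-form `ψ dt`.
Conversely, if `c ≠ 0`, the slice of `∂_t X` is a gradient homothetic vector. If `c = 0`, then `σ =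
∂_t ξ` on some slice has zero Hessian and non-zero gradient, and the slice of `X` is a special
collineation with function `σ`. The proviso supplies a gradient Killing vector `Z` with `Z(σ) ≠ 0`,
and `exists_homothetic_gradient` builds the homothetic vector from `X`, `σ` and `Z`.

(B) and (D) use slices and explicit lifts. (E) rests on the fields `∂_t`, `t ∂_t` and `t φ ∂_t + Y`,
the last one for a special collineation `Y` with function `φ`. -/

namespace DecomposableSpace

/-! ### Calculus of partial derivatives -/

/-- `f` is differentiable at `x` with partial derivative `d` in the `j`-th direction. -/
def HasPD {m : ℕ} (f : (Fin m → ℝ) → ℝ) (j : Fin m) (x : Fin m → ℝ) (d : ℝ) : Prop :=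
  DifferentiableAt ℝ f x ∧ pd f j x = d

theorem HasPD.eq {m : ℕ} {f : (Fin m → ℝ) → ℝ} {j : Fin m} {x : Fin m → ℝ} {d : ℝ}
    (h : HasPD f j x d) : pd f j x = d := h.2

theorem HasPD.of_smooth {m : ℕ} {U : Set (Fin m → ℝ)} (hU : IsOpen U) {f : (Fin m → ℝ) → ℝ}
    (hf : ContDiffOn ℝ ∞ f U) (j : Fin m) {x : Fin m → ℝ} (hx : x ∈ U) :
    HasPD f j x (pd f j x) :=
  ⟨(hf.contDiffAt (hU.mem_nhds hx)).differentiableAt (by simp), rfl⟩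

theorem HasPD.const {m : ℕ} (c : ℝ) (j : Fin m) (x : Fin m → ℝ) :
    HasPD (fun _ => c) j x 0 :=
  ⟨differentiableAt_const c, by simp [pd]⟩

theorem HasPD.add {m : ℕ} {f h : (Fin m → ℝ) → ℝ} {j : Fin m} {x : Fin m → ℝ} {a b : ℝ}
    (hf : HasPD f j x a) (hh : HasPD h j x b) : HasPD (fun y => f y + h y) j x (a + b) := by
  refine ⟨hf.1.add hh.1, ?_⟩
  rw [← hf.2, ← hh.2, pd, fderiv_fun_add hf.1 hh.1]
  rfl

theorem HasPD.sub {m : ℕ} {f h : (Fin m → ℝ) → ℝ} {j : Fin m} {x : Fin m → ℝ} {a b : ℝ}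
    (hf : HasPD f j x a) (hh : HasPD h j x b) : HasPD (fun y => f y - h y) j x (a - b) := by
  refine ⟨hf.1.sub hh.1, ?_⟩
  rw [← hf.2, ← hh.2, pd, fderiv_fun_sub hf.1 hh.1]
  rfl

theorem HasPD.mul {m : ℕ} {f h : (Fin m → ℝ) → ℝ} {j : Fin m} {x : Fin m → ℝ} {a b : ℝ}
    (hf : HasPD f j x a) (hh : HasPD h j x b) :
    HasPD (fun y => f y * h y) j x (a * h x + f x * b) := by
  refine ⟨hf.1.mul hh.1, ?_⟩
  rw [← hf.2, ← hh.2, pd, fderiv_fun_mul hf.1 hh.1]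
  simp [pd]
  ring

theorem HasPD.const_mul {m : ℕ} {f : (Fin m → ℝ) → ℝ} {j : Fin m} {x : Fin m → ℝ} {a : ℝ}
    (c : ℝ) (hf : HasPD f j x a) : HasPD (fun y => c * f y) j x (c * a) := by
  simpa using (HasPD.const c j x).mul hf

theorem HasPD.sum {m : ℕ} {ι : Type*} {s : Finset ι} {f : ι → (Fin m → ℝ) → ℝ} {j : Fin m}
    {x : Fin m → ℝ} {a : ι → ℝ} (hf : ∀ i ∈ s, HasPD (f i) j x (a i)) :
    HasPD (fun y => ∑ i ∈ s, f i y) j x (∑ i ∈ s, a i) := by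
  refine ⟨DifferentiableAt.fun_sum fun i hi => (hf i hi).1, ?_⟩
  rw [pd, fderiv_fun_sum fun i hi => (hf i hi).1]
  simp only [FunLike.coe_sum, Finset.sum_apply]
  exact Finset.sum_congr rfl fun i hi => (hf i hi).2

theorem HasPD.congr {m : ℕ} {U : Set (Fin m → ℝ)} (hU : IsOpen U) {f h : (Fin m → ℝ) → ℝ}
    {j : Fin m} {x : Fin m → ℝ} {d : ℝ} (hh : HasPD h j x d) (hfh : ∀ y ∈ U, f y = h y)
    (hx : x ∈ U) : HasPD f j x d :=
  ⟨hh.1.congr_of_eventuallyEq (Filter.eventuallyEq_of_mem (hU.mem_nhds hx) hfh),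
    (pd_congr hU hfh j hx).trans hh.2⟩

theorem pd_const {m : ℕ} (c : ℝ) (j : Fin m) (x : Fin m → ℝ) : pd (fun _ => c) j x = 0 :=
  (HasPD.const c j x).eq

theorem pd_comm {m : ℕ} {U : Set (Fin m → ℝ)} (hU : IsOpen U) {f : (Fin m → ℝ) → ℝ}
    (hf : ContDiffOn ℝ ∞ f U) (i j : Fin m) {x : Fin m → ℝ} (hx : x ∈ U) :
    pd (pd f i) j x = pd (pd f j) i x := by
  have hc := hf.contDiffAt (hU.mem_nhds hx)
  have hs : IsSymmSndFDerivAt ℝ f x := hc.isSymmSndFDerivAt (by simpa using WithTop.coe_le_coe.2 (le_top : (2 : ℕ∞) ≤ ⊤))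
  have hd : DifferentiableAt ℝ (fderiv ℝ f) x :=
    (hc.fderiv_right (m := ∞) (by simp)).differentiableAt (by simp)
  have key : ∀ a b : Fin m, pd (pd f a) b x
      = fderiv ℝ (fderiv ℝ f) x (Pi.single b 1) (Pi.single a 1) := by
    intro a b
    change fderiv ℝ (fun y => fderiv ℝ f y (Pi.single a 1)) x (Pi.single b 1) = _
    rw [fderiv_clm_apply hd (differentiableAt_const _)]
    simp
  rw [key, key]
  exact hs _ _

/-- A smooth function on a connected open set with vanishing partial derivatives is constant. -/
theorem eq_of_pd_eq_zero {m : ℕ} {U : Set (Fin m → ℝ)} (hU : IsOpen U) (hc : IsConnected U)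
    {f : (Fin m → ℝ) → ℝ} (hf : ContDiffOn ℝ ∞ f U) (h : ∀ x ∈ U, ∀ j, pd f j x = 0)
    {x y : Fin m → ℝ} (hx : x ∈ U) (hy : y ∈ U) : f x = f y := by
  refine hU.is_const_of_fderiv_eq_zero hc.isPreconnected (𝕜 := ℝ)
    (hf.differentiableOn (by simp)) (fun z hz => ?_) hx hy
  ext v
  have hv : v = ∑ j, v j • (Pi.single j (1 : ℝ) : Fin m → ℝ) := by
    ext k
    simp [Finset.sum_apply, Pi.single_apply]
  rw [hv, map_sum]
  refine Finset.sum_eq_zero fun j _ => ?_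
  rw [map_smul]
  have := h z hz j
  rw [pd] at this
  rw [this, smul_zero]

/-- The components `X^i_{;j}` of the covariant derivative of a vector field. -/
noncomputable def covDeriv {m : ℕ} (g : (Fin m → ℝ) → Matrix (Fin m) (Fin m) ℝ)
    (X : (Fin m → ℝ) → Fin m → ℝ) (i j : Fin m) (x : Fin m → ℝ) : ℝ :=
  pd (fun y => X y i) j x + ∑ s, christoffel g i s j x * X x s

/-- The components `X_i = g_{ij} X^j`. -/
noncomputable def lower {m : ℕ} (g : (Fin m → ℝ) → Matrix (Fin m) (Fin m) ℝ)
    (X : (Fin m → ℝ) → Fin m → ℝ) (i : Fin m) (x : Fin m → ℝ) : ℝ :=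
  ∑ j, g x i j * X x j

/-! ### Levi-Civita connection and Lie derivatives of a single metric -/

section Space

variable {m : ℕ} {U : Set (Fin m → ℝ)} {g : (Fin m → ℝ) → Matrix (Fin m) (Fin m) ℝ}

theorem smooth_det (hg : ∀ i j, ContDiffOn ℝ ∞ (fun x => g x i j) U) :
    ContDiffOn ℝ ∞ (fun x => (g x).det) U := by
  simp only [Matrix.det_apply']
  exact ContDiffOn.sum fun σ _ => contDiffOn_const.mul (contDiffOn_prod fun i _ => hg _ _)

theorem smooth_inv (hg : IsMetricOn U g) (i j : Fin m) :
    ContDiffOn ℝ ∞ (fun x => (g x)⁻¹ i j) U := by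
  -- Cramer's rule: each entry of the inverse is a quotient of determinants with smooth entries.
  have h : ∀ x, (g x)⁻¹ i j = (g x).det⁻¹ * ((g x).updateRow j (Pi.single i 1)).det := by
    intro x
    rw [Matrix.inv_def, Ring.inverse_eq_inv', Matrix.smul_apply, Matrix.adjugate_apply,
      smul_eq_mul]
  simp only [h]
  refine ((smooth_det hg.smooth).inv hg.nondeg).mul
    (smooth_det (g := fun x => (g x).updateRow j (Pi.single i 1)) fun a b => ?_)
  by_cases hb : a = j
  · subst hb
    simpa using contDiffOn_const
  · simpa [Matrix.updateRow_ne hb] using hg.smooth a b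

theorem smooth_christoffel (hU : IsOpen U) (hg : IsMetricOn U g) (i j k : Fin m) :
    ContDiffOn ℝ ∞ (christoffel g i j k) U := by
  unfold christoffel
  exact contDiffOn_const.mul (ContDiffOn.sum fun l _ => (smooth_inv hg i l).mul
    (((pd_smooth hU (hg.smooth l k) j).add (pd_smooth hU (hg.smooth l j) k)).sub
      (pd_smooth hU (hg.smooth j k) l)))

theorem IsMetricOn.apply_comm (hg : IsMetricOn U g) {x : Fin m → ℝ} (hx : x ∈ U) (i j : Fin m) :
    g x i j = g x j i :=
  (hg.symm x hx).apply j i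

theorem pd_metric_comm (hU : IsOpen U) (hg : IsMetricOn U g) {x : Fin m → ℝ} (hx : x ∈ U)
    (i j k : Fin m) : pd (fun y => g y i j) k x = pd (fun y => g y j i) k x :=
  pd_congr hU (fun _ hy => hg.apply_comm hy i j) k hx

theorem christoffel_comm (hU : IsOpen U) (hg : IsMetricOn U g) {x : Fin m → ℝ} (hx : x ∈ U)
    (i j k : Fin m) : christoffel g i j k x = christoffel g i k j x := by
  unfold christoffel
  congr 1
  refine Finset.sum_congr rfl fun l _ => ?_
  rw [pd_metric_comm hU hg hx j k l]
  ring

theorem IsMetricOn.sum_mul_inv (hg : IsMetricOn U g) {x : Fin m → ℝ} (hx : x ∈ U)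
    (v : Fin m → ℝ) (i : Fin m) : ∑ r, g x i r * ∑ l, (g x)⁻¹ r l * v l = v i := by
  have h : (g x).mulVec ((g x)⁻¹.mulVec v) = v := by
    rw [Matrix.mulVec_mulVec, Matrix.mul_nonsing_inv _ (isUnit_iff_ne_zero.2 (hg.nondeg x hx)),
      Matrix.one_mulVec]
  exact congrFun h i

theorem IsMetricOn.eq_of_lower_eq (hg : IsMetricOn U g) {x : Fin m → ℝ} (hx : x ∈ U)
    {v w : Fin m → ℝ} (h : ∀ i, ∑ r, g x i r * v r = ∑ r, g x i r * w r) : v = w :=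
  Matrix.mulVec_injective_of_isUnit
    ((Matrix.isUnit_iff_isUnit_det _).2 (isUnit_iff_ne_zero.2 (hg.nondeg x hx))) (funext h)

/-- Contracting with the metric cancels the inverse metric in the definition and leaves the
Christoffel symbols of the first kind. -/
theorem lower_christoffel (hg : IsMetricOn U g) {x : Fin m → ℝ} (hx : x ∈ U) (i j k : Fin m) :
    ∑ r, g x i r * christoffel g r j k x = (1 / 2) *
      (pd (fun y => g y i k) j x + pd (fun y => g y i j) k x - pd (fun y => g y j k) i x) := by
  rw [← hg.sum_mul_inv hx (fun l =>
    pd (fun y => g y l k) j x + pd (fun y => g y l j) k x - pd (fun y => g y j k) l x) i,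
    Finset.mul_sum]
  refine Finset.sum_congr rfl fun r _ => ?_
  unfold christoffel
  ring

/-- The Levi-Civita connection is metric. -/
theorem pd_metric (hU : IsOpen U) (hg : IsMetricOn U g) {x : Fin m → ℝ} (hx : x ∈ U)
    (i j k : Fin m) : pd (fun y => g y i j) k x
      = ∑ r, (g x r j * christoffel g r i k x + g x i r * christoffel g r j k x) := by
  rw [Finset.sum_add_distrib, lower_christoffel hg hx,
    Finset.sum_congr rfl fun r _ => by rw [hg.apply_comm hx r j], lower_christoffel hg hx,
    pd_metric_comm hU hg hx j i, pd_metric_comm hU hg hx j k, pd_metric_comm hU hg hx i k,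
    pd_metric_comm hU hg hx k j]
  ring

theorem lieMetric_eq (hU : IsOpen U) (hg : IsMetricOn U g) (X : (Fin m → ℝ) → Fin m → ℝ)
    {x : Fin m → ℝ} (hx : x ∈ U) (i j : Fin m) :
    lieMetric g X i j x = ∑ r, (g x r j * covDeriv g X r i x + g x i r * covDeriv g X r j x) := by
  unfold lieMetric covDeriv
  simp only [pd_metric hU hg hx, Finset.mul_sum, mul_add, Finset.sum_add_distrib]
  -- Metric compatibility turns `X^k ∂_k g_{ij}` into double sums; exchanging the dummy indices
  -- matches them with the connection terms of the two covariant derivatives.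
  rw [Finset.sum_comm, Finset.sum_comm (f := fun a b => X x a * (g x i b * _))]
  simp only [christoffel_comm hU hg hx _ i, christoffel_comm hU hg hx _ j]
  rw [Finset.sum_congr rfl fun y _ => Finset.sum_congr rfl fun s _ =>
      show X x s * (g x y j * christoffel g y s i x) = g x y j * (christoffel g y s i x * X x s) by
        ring,
    Finset.sum_congr rfl fun y _ => Finset.sum_congr rfl fun s _ =>
      show X x s * (g x i y * christoffel g y s j x) = g x i y * (christoffel g y s j x * X x s) by
        ring]
  ring

theorem smooth_lieMetric (hU : IsOpen U) (hg : IsMetricOn U g) {X : (Fin m → ℝ) → Fin m → ℝ}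
    (hX : IsVectorField U X) (i j : Fin m) : ContDiffOn ℝ ∞ (lieMetric g X i j) U := by
  unfold lieMetric
  exact ContDiffOn.sum fun k _ => (((hX k).mul (pd_smooth hU (hg.smooth i j) k)).add
    ((hg.smooth k j).mul (pd_smooth hU (hX k) i))).add
    ((hg.smooth i k).mul (pd_smooth hU (hX k) j))

theorem lieMetric_comm (hU : IsOpen U) (hg : IsMetricOn U g) (X : (Fin m → ℝ) → Fin m → ℝ)
    {x : Fin m → ℝ} (hx : x ∈ U) (i j : Fin m) : lieMetric g X i j x = lieMetric g X j i x := by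
  unfold lieMetric
  refine Finset.sum_congr rfl fun k _ => ?_
  rw [pd_metric_comm hU hg hx i j, hg.apply_comm hx k j, hg.apply_comm hx i k]
  ring

theorem lieConnection_comm (hU : IsOpen U) (hg : IsMetricOn U g) {X : (Fin m → ℝ) → Fin m → ℝ}
    (hX : IsVectorField U X) {x : Fin m → ℝ} (hx : x ∈ U) (i j k : Fin m) :
    lieConnection g X i j k x = lieConnection g X i k j x := by
  unfold lieConnection
  congr 1
  · exact pd_comm hU (hX i) j k hx
  refine Finset.sum_congr rfl fun r _ => ?_
  rw [christoffel_comm hU hg hx r j k, christoffel_comm hU hg hx i r k,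
    christoffel_comm hU hg hx i j r,
    pd_congr hU (fun y hy => christoffel_comm hU hg hy i j k) r hx]
  ring

/-- `(L_X g)_{ij;k} = g_{rj} (L_X Γ)^r_{ik} + g_{ir} (L_X Γ)^r_{jk}`. -/
theorem pd_lieMetric (hU : IsOpen U) (hg : IsMetricOn U g) {X : (Fin m → ℝ) → Fin m → ℝ}
    (hX : IsVectorField U X) {x : Fin m → ℝ} (hx : x ∈ U) (i j k : Fin m) :
    pd (lieMetric g X i j) k x
      = ∑ r, (g x r j * lieConnection g X r i k x + g x i r * lieConnection g X r j k x)
        + ∑ r, (christoffel g r i k x * lieMetric g X r j x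
          + christoffel g r j k x * lieMetric g X i r x) := by
  have hG : ∀ a b c, HasPD (fun y => g y a b) c x (pd (fun y => g y a b) c x) :=
    fun a b c => .of_smooth hU (hg.smooth a b) c hx
  have hGG : ∀ a b c d, HasPD (pd (fun y => g y a b) c) d x (pd (pd (fun y => g y a b) c) d x) :=
    fun a b c d => .of_smooth hU (pd_smooth hU (hg.smooth a b) c) d hx
  have hC : ∀ a b c d, HasPD (christoffel g a b c) d x (pd (christoffel g a b c) d x) :=
    fun a b c d => .of_smooth hU (smooth_christoffel hU hg a b c) d hx
  have hV : ∀ a c, HasPD (fun y => X y a) c x (pd (fun y => X y a) c x) :=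
    fun a c => .of_smooth hU (hX a) c hx
  have hVV : ∀ a c d, HasPD (pd (fun y => X y a) c) d x (pd (pd (fun y => X y a) c) d x) :=
    fun a c d => .of_smooth hU (pd_smooth hU (hX a) c) d hx
  -- The two derivatives are exchanged before metric compatibility is applied, so that only `∂_s
  -- Γ^r_{ik}` and `∂_s Γ^r_{jk}` occur, exactly the derivatives of `Γ` in `L_X Γ`.
  have h2 : ∀ s, pd (pd (fun y => g y i j) s) k x = ∑ r,
      ((pd (fun y => g y r j) s x * christoffel g r i k x
        + g x r j * pd (christoffel g r i k) s x)
      + (pd (fun y => g y i r) s x * christoffel g r j k x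
        + g x i r * pd (christoffel g r j k) s x)) := by
    intro s
    rw [pd_comm hU (hg.smooth i j) s k hx]
    exact ((HasPD.sum fun r _ => ((hG r j s).mul (hC r i k s)).add
      ((hG i r s).mul (hC r j k s))).congr hU (fun y hy => pd_metric hU hg hy i j k) hx).eq
  have h1 : pd (lieMetric g X i j) k x = _ :=
    (HasPD.sum fun s _ => (((hV s k).mul (hGG i j s k)).add
      ((hG s j k).mul (hVV s i k))).add ((hG i s k).mul (hVV s j k))).eq
  have e1 : ∀ s, pd (fun y => g y i j) s x = _ := fun s => pd_metric hU hg hx i j s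
  have e2 : ∀ s, pd (fun y => g y s j) k x = _ := fun s => pd_metric hU hg hx s j k
  have e3 : ∀ s, pd (fun y => g y i s) k x = _ := fun s => pd_metric hU hg hx i s k
  -- The dummy indices of the negative term are renamed so that `r` is always the upper index of
  -- `Γ`; the final comparison can then be made term by term.
  have hL1 : ∑ r, g x r j * lieConnection g X r i k x
      = ∑ r, (g x r j * pd (pd (fun y => X y r) i) k x
        + ∑ s, (g x r j * X x s * pd (christoffel g r i k) s x
          - g x s j * pd (fun y => X y s) r x * christoffel g r i k x
          + g x r j * pd (fun y => X y s) i x * christoffel g r s k x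
          + g x r j * pd (fun y => X y s) k x * christoffel g r i s x)) := by
    unfold lieConnection
    simp only [mul_add, Finset.mul_sum, Finset.sum_add_distrib, mul_sub, Finset.sum_sub_distrib,
      mul_assoc]
    rw [Finset.sum_comm (f := fun r s => g x s j * _)]
  have hL2 : ∑ r, g x i r * lieConnection g X r j k x
      = ∑ r, (g x i r * pd (pd (fun y => X y r) j) k x
        + ∑ s, (g x i r * X x s * pd (christoffel g r j k) s x
          - g x i s * pd (fun y => X y s) r x * christoffel g r j k x
          + g x i r * pd (fun y => X y s) j x * christoffel g r s k x
          + g x i r * pd (fun y => X y s) k x * christoffel g r j s x)) := by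
    unfold lieConnection
    simp only [mul_add, Finset.mul_sum, Finset.sum_add_distrib, mul_sub, Finset.sum_sub_distrib,
      mul_assoc]
    rw [Finset.sum_comm (f := fun r s => g x i s * _)]
  have hR : ∑ r, (g x r j * lieConnection g X r i k x + g x i r * lieConnection g X r j k x)
      = ∑ r, g x r j * lieConnection g X r i k x + ∑ r, g x i r * lieConnection g X r j k x :=
    Finset.sum_add_distrib ..
  rw [h1, hR, hL1, hL2]
  unfold lieMetric
  -- First derivatives of `g` that multiply a Christoffel symbol stay unexpanded: they reappear
  -- inside the Lie derivatives of `g` on the other side.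
  have hl : ∀ s, pd (fun y => X y s) k x * pd (fun y => g y i j) s x
        + X x s * pd (pd (fun y => g y i j) s) k x
        + (pd (fun y => g y s j) k x * pd (fun y => X y s) i x
          + g x s j * pd (pd (fun y => X y s) i) k x)
        + (pd (fun y => g y i s) k x * pd (fun y => X y s) j x
          + g x i s * pd (pd (fun y => X y s) j) k x)
      = (g x s j * pd (pd (fun y => X y s) i) k x + g x i s * pd (pd (fun y => X y s) j) k x)
        + ∑ r, (pd (fun y => X y s) k x
            * (g x r j * christoffel g r i s x + g x i r * christoffel g r j s x)
          + X x s * ((pd (fun y => g y r j) s x * christoffel g r i k x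
              + g x r j * pd (christoffel g r i k) s x)
            + (pd (fun y => g y i r) s x * christoffel g r j k x
              + g x i r * pd (christoffel g r j k) s x))
          + (g x r j * christoffel g r s k x + g x s r * christoffel g r j k x)
            * pd (fun y => X y s) i x
          + (g x r s * christoffel g r i k x + g x i r * christoffel g r s k x)
            * pd (fun y => X y s) j x) := by
    intro s
    rw [h2, e1, e2, e3]
    simp only [Finset.sum_add_distrib, Finset.mul_sum, Finset.sum_mul, mul_add, add_mul]
    ring
  rw [Finset.sum_congr rfl fun s _ => hl s, Finset.sum_add_distrib, Finset.sum_comm]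
  simp only [Finset.mul_sum, ← Finset.sum_add_distrib]
  refine Finset.sum_congr rfl fun r _ => ?_
  have reorder : ∀ a b p q q' r : ℝ, p = q + q' + r → a + b + p = a + q + (b + q') + r := by
    intros
    linarith
  refine reorder _ _ _ _ _ _ ?_
  rw [← Finset.sum_add_distrib, ← Finset.sum_add_distrib]
  refine Finset.sum_congr rfl fun s _ => ?_
  ring

end Space

/-! ### Killing, homothetic and concircular fields -/

section Space

variable {m : ℕ} {U : Set (Fin m → ℝ)} {g : (Fin m → ℝ) → Matrix (Fin m) (Fin m) ℝ}

theorem smooth_lower (hg : IsMetricOn U g) {X : (Fin m → ℝ) → Fin m → ℝ}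
    (hX : IsVectorField U X) (i : Fin m) : ContDiffOn ℝ ∞ (lower g X i) U := by
  unfold lower
  exact ContDiffOn.sum fun j _ => (hg.smooth i j).mul (hX j)

/-- `X_{i;k} = g_{ir} X^r_{;k}`. -/
theorem pd_lower (hU : IsOpen U) (hg : IsMetricOn U g) {X : (Fin m → ℝ) → Fin m → ℝ}
    (hX : IsVectorField U X) {x : Fin m → ℝ} (hx : x ∈ U) (i k : Fin m) :
    pd (lower g X i) k x
      = ∑ r, g x i r * covDeriv g X r k x + ∑ r, christoffel g r i k x * lower g X r x := by
  have h : pd (lower g X i) k x = _ := (HasPD.sum fun j _ =>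
    (HasPD.of_smooth hU (hg.smooth i j) k hx).mul (HasPD.of_smooth hU (hX j) k hx)).eq
  rw [h]
  have hj : ∀ j, pd (fun y => g y i j) k x * X x j + g x i j * pd (fun y => X y j) k x
      = g x i j * pd (fun y => X y j) k x
        + ∑ r, (g x i r * (christoffel g r j k x * X x j)
          + christoffel g r i k x * (g x r j * X x j)) := by
    intro j
    rw [pd_metric hU hg hx, Finset.sum_mul, add_comm]
    congr 1
    refine Finset.sum_congr rfl fun r _ => ?_
    ring
  rw [Finset.sum_congr rfl fun j _ => hj j, Finset.sum_add_distrib, Finset.sum_comm]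
  simp only [covDeriv, lower, Finset.mul_sum, mul_add, Finset.sum_add_distrib]
  ring

/-- Lowering an index commutes with covariant differentiation and is injective, so `X_{i;k} = c
g_{ik}` can be checked on the covector. Only one point is involved. -/
theorem covDeriv_of_pd_lower (hU : IsOpen U) (hg : IsMetricOn U g)
    {X : (Fin m → ℝ) → Fin m → ℝ} (hX : IsVectorField U X) {x : Fin m → ℝ} (hx : x ∈ U) {c : ℝ}
    {k : Fin m} (h : ∀ i, pd (lower g X i) k x
      = c * g x i k + ∑ r, christoffel g r i k x * lower g X r x) (i : Fin m) :
    covDeriv g X i k x = if i = k then c else 0 := by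
  refine congrFun (hg.eq_of_lower_eq hx (v := fun i => covDeriv g X i k x)
    (w := fun i => if i = k then c else 0) fun a => ?_) i
  have := h a
  rw [pd_lower hU hg hX hx] at this
  simp only [mul_ite, mul_zero, Finset.sum_ite_eq', Finset.mem_univ, if_true]
  linarith

/-- The factor `c` belongs to a single point, so this also serves fields whose factor is a
non-constant function. -/
theorem lieMetric_of_covDeriv (hU : IsOpen U) (hg : IsMetricOn U g)
    {X : (Fin m → ℝ) → Fin m → ℝ} {x : Fin m → ℝ} (hx : x ∈ U) {c : ℝ}
    (h : ∀ i k, covDeriv g X i k x = if i = k then c else 0) (i j : Fin m) :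
    lieMetric g X i j x = 2 * c * g x i j := by
  rw [lieMetric_eq hU hg X hx]
  simp only [h, mul_ite, mul_zero, Finset.sum_add_distrib, Finset.sum_ite_eq', Finset.mem_univ,
    if_true]
  ring

/-- A vector field with `X^i_{;k} = c δ^i_k`, `c ≠ 0` constant, is a gradient homothetic vector;
a potential is `X_i X^i / (2 c)`. -/
theorem homothetic_gradient_of_covDeriv (hU : IsOpen U) (hg : IsMetricOn U g)
    {X : (Fin m → ℝ) → Fin m → ℝ} (hX : IsVectorField U X) {c : ℝ} (hc : c ≠ 0)
    (h : ∀ x ∈ U, ∀ i k, covDeriv g X i k x = if i = k then c else 0) :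
    IsHomothetic U g X ∧ IsGradient U g X := by
  refine ⟨⟨hX, c, hc, fun x hx => lieMetric_of_covDeriv hU hg hx (h x hx)⟩,
    fun x => 1 / (2 * c) * ∑ i, lower g X i x * X x i,
    contDiffOn_const.mul (ContDiffOn.sum fun i _ => (smooth_lower hg hX i).mul (hX i)),
    fun x hx k => ?_⟩
  have hd : pd (fun x => 1 / (2 * c) * ∑ i, lower g X i x * X x i) k x = _ :=
    ((HasPD.sum fun i _ => (HasPD.of_smooth hU (smooth_lower hg hX i) k hx).mul
      (HasPD.of_smooth hU (hX i) k hx)).const_mul (1 / (2 * c))).eq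
  have hcov : ∀ i, pd (fun y => X y i) k x
      = (if i = k then c else 0) - ∑ s, christoffel g i s k x * X x s := by
    intro i
    rw [← h x hx i k, covDeriv]
    ring
  -- The connection terms from the lowered and the raised factor cancel; each factor contributes `c
  -- X_k`.
  have key : ∑ i, (pd (lower g X i) k x * X x i + lower g X i x * pd (fun y => X y i) k x)
      = 2 * c * lower g X k x := by
    simp only [pd_lower hU hg hX hx, h x hx, hcov, add_mul, mul_sub, Finset.sum_add_distrib,
      Finset.sum_sub_distrib, mul_ite, mul_zero, Finset.sum_ite_eq', Finset.mem_univ, if_true,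
      Finset.mul_sum, Finset.sum_mul]
    rw [Finset.sum_comm (f := fun i r => christoffel g r i k x * lower g X r x * X x i)]
    have e1 : ∑ i, g x i k * c * X x i = c * lower g X k x := by
      rw [lower, Finset.mul_sum]
      refine Finset.sum_congr rfl fun i _ => ?_
      rw [hg.apply_comm hx i k]
      ring
    have e2 : ∀ r s, christoffel g r s k x * lower g X r x * X x s
        = lower g X r x * (christoffel g r s k x * X x s) := fun r s => by ring
    rw [e1]
    simp only [e2]
    ring
  rw [hd, key]
  change lower g X k x = _
  field_simp

/-- For a gradient, `X_{i;k}` is symmetric because second derivatives commute and the connection is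
torsion-free. It is thus half of `L_X g`, which determines it. The Killing case is `c = 0`. -/
theorem covDeriv_of_gradient (hU : IsOpen U) (hg : IsMetricOn U g)
    {X : (Fin m → ℝ) → Fin m → ℝ} (hX : IsVectorField U X) (hS : IsGradient U g X) {c : ℝ}
    (hc : ∀ x ∈ U, ∀ i j, lieMetric g X i j x = 2 * c * g x i j) {x : Fin m → ℝ} (hx : x ∈ U)
    (i k : Fin m) : covDeriv g X i k x = if i = k then c else 0 := by
  obtain ⟨S, hS, hXS⟩ := hS
  have hlow : ∀ a b, pd (lower g X a) b x = pd (pd S a) b x := fun a b =>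
    pd_congr hU (fun y hy => hXS y hy a) b hx
  have hsym : ∀ a b, ∑ r, g x a r * covDeriv g X r b x = ∑ r, g x b r * covDeriv g X r a x := by
    intro a b
    have h1 := pd_lower hU hg hX hx a b
    have h2 := pd_lower hU hg hX hx b a
    rw [hlow] at h1 h2
    rw [pd_comm hU hS a b hx] at h1
    simp only [christoffel_comm hU hg hx _ b a] at h2
    linarith
  refine congrFun (hg.eq_of_lower_eq hx (v := fun i => covDeriv g X i k x)
    (w := fun i => if i = k then c else 0) fun a => ?_) i
  have h1 := hc x hx a k
  rw [lieMetric_eq hU hg X hx, Finset.sum_add_distrib,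
    Finset.sum_congr rfl fun r _ => by rw [hg.apply_comm hx r k], ← hsym a k] at h1
  simp only [mul_ite, mul_zero, Finset.sum_ite_eq', Finset.mem_univ, if_true]
  linarith

/-- If `(L_X g)_{ij;k} = 0` then `L_X Γ = 0`; here for homothetic and Killing vectors. -/
theorem lieConnection_of_lieMetric (hU : IsOpen U) (hg : IsMetricOn U g)
    {X : (Fin m → ℝ) → Fin m → ℝ} (hX : IsVectorField U X) {c : ℝ}
    (hc : ∀ x ∈ U, ∀ i j, lieMetric g X i j x = 2 * c * g x i j) {x : Fin m → ℝ} (hx : x ∈ U)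
    (i j k : Fin m) : lieConnection g X i j k x = 0 := by
  -- With its upper index lowered, `L_X Γ` is skew in the first two indices, since `(L_X g)_{ab;d} =
  -- 0`, and symmetric in the last two. Such a tensor vanishes, by the cyclic argument that proves
  -- uniqueness of the Levi-Civita connection.
  have hsum : ∀ a b d, ∑ r, g x a r * lieConnection g X r b d x
      + ∑ r, g x b r * lieConnection g X r a d x = 0 := by
    intro a b d
    have h1 := pd_lieMetric hU hg hX hx a b d
    have h2 : pd (lieMetric g X a b) d x = 2 * c * pd (fun y => g y a b) d x :=
      (((HasPD.of_smooth hU (hg.smooth a b) d hx).const_mul (2 * c)).congr hU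
        (fun y hy => hc y hy a b) hx).eq
    rw [h2, pd_metric hU hg hx] at h1
    simp only [hc x hx] at h1
    have h3 : ∑ r, (christoffel g r a d x * (2 * c * g x r b)
        + christoffel g r b d x * (2 * c * g x a r))
        = 2 * c * ∑ r, (g x r b * christoffel g r a d x + g x a r * christoffel g r b d x) := by
      rw [Finset.mul_sum]
      refine Finset.sum_congr rfl fun r _ => ?_
      ring
    have h4 : ∑ r, (g x r b * lieConnection g X r a d x + g x a r * lieConnection g X r b d x)
        = ∑ r, g x a r * lieConnection g X r b d x
          + ∑ r, g x b r * lieConnection g X r a d x := by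
      rw [← Finset.sum_add_distrib]
      refine Finset.sum_congr rfl fun r _ => ?_
      rw [hg.apply_comm hx r b]
      ring
    rw [h3, h4] at h1
    linarith
  have hs : ∀ a b d, ∑ r, g x a r * lieConnection g X r b d x
      = ∑ r, g x a r * lieConnection g X r d b x := fun a b d =>
    Finset.sum_congr rfl fun r _ => by rw [lieConnection_comm hU hg hX hx]
  refine congrFun (hg.eq_of_lower_eq hx (v := fun i => lieConnection g X i j k x)
    (w := fun _ => 0) fun a => ?_) i
  have h1 := hsum a j k
  have h2 := hsum j k a
  have h3 := hsum k a j
  have h4 := hs j k a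
  have h5 := hs k a j
  have h6 := hs a k j
  simp only [mul_zero, Finset.sum_const_zero]
  linarith

/-- If `X^i_{;k} = ρ δ^i_k` and `X` is a projective collineation with one-form `2 dρ`, then `ρ` is
locally constant. -/
theorem pd_eq_zero_of_concircular (hU : IsOpen U) (hg : IsMetricOn U g)
    {X : (Fin m → ℝ) → Fin m → ℝ} (hX : IsVectorField U X) {ρ : (Fin m → ℝ) → ℝ}
    (hρ : ContDiffOn ℝ ∞ ρ U)
    (h : ∀ x ∈ U, ∀ i k, covDeriv g X i k x = if i = k then ρ x else 0)
    {x : Fin m → ℝ} (hx : x ∈ U)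
    (hL : ∀ i j k, lieConnection g X i j k x
      = (if i = k then 2 * pd ρ j x else 0) + (if i = j then 2 * pd ρ k x else 0)) (k : Fin m) :
    pd ρ k x = 0 := by
  have hc : ∀ y ∈ U, ∀ i j, lieMetric g X i j y = 2 * ρ y * g y i j := fun y hy =>
    lieMetric_of_covDeriv hU hg hy (h y hy)
  -- The derivative of `L_X g = 2 ρ g` is `2 ρ_{,k} g_{ij}`, while the projective equation gives `4
  -- ρ_{,k} g_{ij} + 2 ρ_{,i} g_{kj} + 2 ρ_{,j} g_{ik}`.
  have key : ∀ i j, g x i j * pd ρ k x + g x k j * pd ρ i x + g x i k * pd ρ j x = 0 := by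
    intro i j
    have h1 := pd_lieMetric hU hg hX hx i j k
    have h2 : pd (lieMetric g X i j) k x = _ :=
      ((((HasPD.of_smooth hU hρ k hx).const_mul 2).mul
        (HasPD.of_smooth hU (hg.smooth i j) k hx)).congr hU (fun y hy => hc y hy i j) hx).eq
    rw [h2, pd_metric hU hg hx] at h1
    simp only [hc x hx, hL, mul_add, mul_ite, mul_zero, Finset.sum_add_distrib,
      Finset.sum_ite_eq', Finset.mem_univ, if_true] at h1
    have h3 : ∀ a b, ∑ r, christoffel g r a k x * (2 * ρ x * g x r b)
        = 2 * ρ x * ∑ r, g x r b * christoffel g r a k x := by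
      intro a b
      rw [Finset.mul_sum]
      refine Finset.sum_congr rfl fun r _ => ?_
      ring
    have h4 : ∀ a b, ∑ r, christoffel g r a k x * (2 * ρ x * g x b r)
        = 2 * ρ x * ∑ r, g x b r * christoffel g r a k x := by
      intro a b
      rw [Finset.mul_sum]
      refine Finset.sum_congr rfl fun r _ => ?_
      ring
    rw [h3, h4] at h1
    linarith
  have hdet : IsUnit (g x).det := isUnit_iff_ne_zero.2 (hg.nondeg x hx)
  have hi1 : ∀ a b, ∑ j, g x a j * (g x)⁻¹ j b = if a = b then 1 else 0 := fun a b => by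
    rw [← Matrix.mul_apply, Matrix.mul_nonsing_inv _ hdet, Matrix.one_apply]
  have hi2 : ∀ a b, ∑ j, (g x)⁻¹ a j * g x j b = if a = b then 1 else 0 := fun a b => by
    rw [← Matrix.mul_apply, Matrix.nonsing_inv_mul _ hdet, Matrix.one_apply]
  -- Trace with the inverse metric: the first term contributes the dimension `m`, the other two
  -- contribute one each.
  have hsum : ∑ i, ∑ j, (g x i j * (g x)⁻¹ j i * pd ρ k x + g x k j * (g x)⁻¹ j i * pd ρ i x
      + (g x)⁻¹ j i * g x i k * pd ρ j x) = 0 :=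
    Finset.sum_eq_zero fun i _ => Finset.sum_eq_zero fun j _ => by
      linear_combination (g x)⁻¹ j i * key i j
  simp only [Finset.sum_add_distrib] at hsum
  rw [Finset.sum_comm (f := fun i j => (g x)⁻¹ j i * g x i k * pd ρ j x)] at hsum
  simp only [← Finset.sum_mul, hi1, hi2] at hsum
  simp only [if_true, Finset.sum_const, Finset.card_univ, Fintype.card_fin, nsmul_eq_mul, mul_one,
    ite_mul, one_mul, zero_mul, Finset.sum_ite_eq, Finset.sum_ite_eq', Finset.mem_univ] at hsum
  have hm : (m : ℝ) + 2 ≠ 0 := by positivity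
  refine (mul_eq_zero.1 (?_ : ((m : ℝ) + 2) * pd ρ k x = 0)).resolve_left hm
  linarith

theorem lower_raise (hg : IsMetricOn U g) (V : Fin m → (Fin m → ℝ) → ℝ) {x : Fin m → ℝ}
    (hx : x ∈ U) (i : Fin m) : lower g (fun y a => ∑ l, (g y)⁻¹ a l * V l y) i x = V i x :=
  hg.sum_mul_inv hx (fun l => V l x) i

/-- A covector field with `V_{i;k} = c g_{ik}`, with index raised, has `X^i_{;k} = c δ^i_k`. -/
theorem covDeriv_raise (hU : IsOpen U) (hg : IsMetricOn U g) {V : Fin m → (Fin m → ℝ) → ℝ}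
    (hV : ∀ i, ContDiffOn ℝ ∞ (V i) U) {c : ℝ}
    (h : ∀ x ∈ U, ∀ i k, pd (V i) k x = c * g x i k + ∑ r, christoffel g r i k x * V r x) :
    IsVectorField U (fun y a => ∑ l, (g y)⁻¹ a l * V l y) ∧
      ∀ x ∈ U, ∀ i k, covDeriv g (fun y a => ∑ l, (g y)⁻¹ a l * V l y) i k x
        = if i = k then c else 0 := by
  have hX : IsVectorField U (fun y a => ∑ l, (g y)⁻¹ a l * V l y) := fun i =>
    ContDiffOn.sum fun l _ => (smooth_inv hg i l).mul (hV l)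
  refine ⟨hX, fun x hx i k => covDeriv_of_pd_lower hU hg hX hx (fun a => ?_) i⟩
  rw [pd_congr hU (fun y hy => lower_raise hg V hy a) k hx, h x hx]
  simp only [lower_raise hg V hx]

/-- The gradient of a function with vanishing Hessian is a gradient Killing vector. -/
theorem killing_gradient_of_hessian (hU : IsOpen U) (hg : IsMetricOn U g)
    {σ : (Fin m → ℝ) → ℝ} (hσ : ContDiffOn ℝ ∞ σ U)
    (h : ∀ x ∈ U, ∀ i j, hessian g σ i j x = 0) :
    IsKilling U g (fun y a => ∑ l, (g y)⁻¹ a l * pd σ l y) ∧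
      IsGradient U g (fun y a => ∑ l, (g y)⁻¹ a l * pd σ l y) := by
  obtain ⟨h1, h2⟩ := covDeriv_raise hU hg (V := fun l => pd σ l) (c := 0)
    (fun l => pd_smooth hU hσ l) fun x hx i k => by
      have := h x hx i k
      rw [hessian] at this
      linarith
  refine ⟨⟨h1, fun x hx i j => ?_⟩, σ, hσ, fun x hx i => lower_raise hg _ hx i⟩
  rw [lieMetric_of_covDeriv hU hg hx (h2 x hx)]
  ring

/-- A special projective collineation with projective function `σ`, together with a gradient
Killing vector that is not orthogonal to the gradient of `σ`, yields a gradient homothetic vector. -/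
theorem exists_homothetic_gradient (hU : IsOpen U) (hUc : IsConnected U) (hg : IsMetricOn U g)
    {X Z : (Fin m → ℝ) → Fin m → ℝ} (hX : IsVectorField U X) {σ : (Fin m → ℝ) → ℝ}
    (hσ : ContDiffOn ℝ ∞ σ U)
    (hL : ∀ x ∈ U, ∀ i j k, lieConnection g X i j k x
      = (if i = k then pd σ j x else 0) + (if i = j then pd σ k x else 0))
    (hh : ∀ x ∈ U, ∀ i j, hessian g σ i j x = 0)
    (hZ : IsKilling U g Z) (hZg : IsGradient U g Z) {x₀ : Fin m → ℝ} (hx₀ : x₀ ∈ U)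
    (hne : ∑ i, pd σ i x₀ * Z x₀ i ≠ 0) :
    ∃ Y, IsHomothetic U g Y ∧ IsGradient U g Y := by
  have hZc : ∀ x ∈ U, ∀ i k, covDeriv g Z i k x = 0 := fun x hx i k => by
    rw [covDeriv_of_gradient hU hg hZ.1 hZg (c := 0) (fun y hy a b => by
      rw [hZ.2 y hy]
      ring) hx, ite_self]
  have hZpd : ∀ x ∈ U, ∀ i k, pd (fun y => Z y i) k x = -∑ s, christoffel g i s k x * Z x s :=
    fun x hx i k => by
      have := hZc x hx i k
      rw [covDeriv] at this
      linarith
  have hσpd : ∀ x ∈ U, ∀ i k, pd (pd σ i) k x = ∑ r, christoffel g r i k x * pd σ r x :=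
    fun x hx i k => by
      have := hh x hx i k
      rw [hessian] at this
      linarith
  obtain ⟨ζ, hζ, hZζ⟩ := hZg
  replace hZζ : ∀ x ∈ U, ∀ i, lower g Z i x = pd ζ i x := hZζ
  have hlpd : ∀ x ∈ U, ∀ i k, pd (lower g Z i) k x = ∑ r, christoffel g r i k x * lower g Z r x :=
    fun x hx i k => by
      rw [pd_lower hU hg hZ.1 hx]
      simp [hZc x hx]
  -- Both `dσ` and `Z` are covariantly constant, hence so is their contraction; connectedness makes
  -- it one constant on all of `U`.
  have hconst : ∀ x ∈ U, ∑ i, pd σ i x * Z x i = ∑ i, pd σ i x₀ * Z x₀ i := by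
    intro x hx
    refine eq_of_pd_eq_zero hU hUc (f := fun x => ∑ i, pd σ i x * Z x i)
      (ContDiffOn.sum fun i _ => (pd_smooth hU hσ i).mul (hZ.1 i)) (fun y hy k => ?_) hx hx₀
    rw [(HasPD.sum fun i _ => (HasPD.of_smooth hU (pd_smooth hU hσ i) k hy).mul
      (HasPD.of_smooth hU (hZ.1 i) k hy)).eq]
    simp only [hσpd y hy, hZpd y hy, Finset.sum_add_distrib, Finset.sum_mul, mul_neg,
      Finset.mul_sum, Finset.sum_neg_distrib]
    rw [Finset.sum_comm, ← sub_eq_add_neg, sub_eq_zero]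
    refine Finset.sum_congr rfl fun i _ => Finset.sum_congr rfl fun s _ => ?_
    ring
  set c := ∑ i, pd σ i x₀ * Z x₀ i with hcdef
  -- The covector is `V_i = (L_X g)_{ij} Z^j - 2 σ Z_i - ζ σ_{,i}`. Contracting `(L_X g)_{ij;k} =
  -- g_{kj} σ_{,i} + 2 g_{ij} σ_{,k} + g_{ik} σ_{,j}` with the parallel field `Z` gives `Z_k σ_{,i}
  -- + 2 σ_{,k} Z_i + c g_{ik}`. The two subtracted terms remove all but the last, because `Z_k =
  -- ζ_{,k}`; so `V_{i;k} = c g_{ik}`.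
  have hsm : ∀ i, ContDiffOn ℝ ∞ (fun x => ∑ j, lieMetric g X i j x * Z x j
      - 2 * (σ x * lower g Z i x) - ζ x * pd σ i x) U := fun i =>
    ((ContDiffOn.sum fun j _ => (smooth_lieMetric hU hg hX i j).mul (hZ.1 j)).sub
      (contDiffOn_const.mul (hσ.mul (smooth_lower hg hZ.1 i)))).sub (hζ.mul (pd_smooth hU hσ i))
  obtain ⟨h1, h2⟩ := covDeriv_raise hU hg (V := fun i x => ∑ j, lieMetric g X i j x * Z x j
      - 2 * (σ x * lower g Z i x) - ζ x * pd σ i x) (c := c) hsm fun x hx i k => by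
    have hV := (((HasPD.sum (s := Finset.univ) fun j _ =>
      (HasPD.of_smooth hU (smooth_lieMetric hU hg hX i j) k hx).mul
        (HasPD.of_smooth hU (hZ.1 j) k hx)).sub
      (((HasPD.of_smooth hU hσ k hx).mul
        (HasPD.of_smooth hU (smooth_lower hg hZ.1 i) k hx)).const_mul 2)).sub
      ((HasPD.of_smooth hU hζ k hx).mul (HasPD.of_smooth hU (pd_smooth hU hσ i) k hx))).eq
    rw [hV]
    have hlm : ∀ j, pd (lieMetric g X i j) k x
        = g x k j * pd σ i x + 2 * (g x i j * pd σ k x) + g x i k * pd σ j x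
          + ∑ r, (christoffel g r i k x * lieMetric g X r j x
            + christoffel g r j k x * lieMetric g X i r x) := by
      intro j
      rw [pd_lieMetric hU hg hX hx]
      simp only [hL x hx, mul_add, mul_ite, mul_zero, Finset.sum_add_distrib,
        Finset.sum_ite_eq', Finset.mem_univ, if_true]
      ring
    have hmain : ∑ j, (pd (lieMetric g X i j) k x * Z x j
          + lieMetric g X i j x * pd (fun y => Z y j) k x)
        = lower g Z k x * pd σ i x + 2 * (pd σ k x * lower g Z i x) + c * g x i k
          + ∑ r, christoffel g r i k x * ∑ j, lieMetric g X r j x * Z x j := by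
      rw [← hconst x hx]
      simp only [hlm, hZpd x hx, lower, add_mul, Finset.sum_mul, Finset.mul_sum, mul_neg,
        Finset.sum_add_distrib, Finset.sum_neg_distrib]
      rw [Finset.sum_comm (f := fun j r => christoffel g r i k x * lieMetric g X r j x * Z x j),
        Finset.sum_comm (f := fun j r => christoffel g r j k x * lieMetric g X i r x * Z x j)]
      have e1 : ∀ j, g x k j * pd σ i x * Z x j = g x k j * Z x j * pd σ i x := fun j => by ring
      have e2 : ∀ j, 2 * (g x i j * pd σ k x) * Z x j = 2 * (pd σ k x * (g x i j * Z x j)) :=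
        fun j => by ring
      have e3 : ∀ j, g x i k * pd σ j x * Z x j = pd σ j x * Z x j * g x i k := fun j => by ring
      have e4 : ∀ r j, christoffel g r i k x * lieMetric g X r j x * Z x j
          = christoffel g r i k x * (lieMetric g X r j x * Z x j) := fun r j => by ring
      have e5 : ∀ r j, christoffel g r j k x * lieMetric g X i r x * Z x j
          = lieMetric g X i r x * (christoffel g r j k x * Z x j) := fun r j => by ring
      simp only [e1, e2, e3, e4, e5]
      ring
    rw [hmain, hlpd x hx, hσpd x hx, ← hZζ x hx k]
    simp only [mul_sub, Finset.sum_sub_distrib]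
    have e1 : ∑ r, christoffel g r i k x * (2 * (σ x * lower g Z r x))
        = 2 * (σ x * ∑ r, christoffel g r i k x * lower g Z r x) := by
      simp only [Finset.mul_sum]
      refine Finset.sum_congr rfl fun r _ => ?_
      ring
    have e2 : ∑ r, christoffel g r i k x * (ζ x * pd σ r x)
        = ζ x * ∑ r, christoffel g r i k x * pd σ r x := by
      simp only [Finset.mul_sum]
      refine Finset.sum_congr rfl fun r _ => ?_
      ring
    rw [e1, e2]
    ring
  exact ⟨_, homothetic_gradient_of_covDeriv hU hg h1 hne h2⟩

end Space

/-! ### Coordinates, slices and the metric of the product -/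

section Product

variable {n : ℕ}

/-- The projection of a point of the decomposable space to the `n`-space. -/
def spacePart (p : Fin (n + 1) → ℝ) : Fin n → ℝ := fun i => p i.succ

/-- The point `(t, x)` of the decomposable space. -/
def point (t : ℝ) (x : Fin n → ℝ) : Fin (n + 1) → ℝ := Fin.cases (motive := fun _ => ℝ) t x

@[simp] theorem point_zero (t : ℝ) (x : Fin n → ℝ) : point t x 0 = t := rfl

@[simp] theorem point_succ (t : ℝ) (x : Fin n → ℝ) (i : Fin n) : point t x i.succ = x i := rfl

@[simp] theorem spacePart_point (t : ℝ) (x : Fin n → ℝ) : spacePart (point t x) = x := rfl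

@[simp] theorem point_spacePart (p : Fin (n + 1) → ℝ) : point (p 0) (spacePart p) = p := by
  funext a
  refine Fin.cases ?_ (fun i => ?_) a <;> rfl

theorem point_mem {I : Set ℝ} {U : Set (Fin n → ℝ)} {t : ℝ} {x : Fin n → ℝ} (ht : t ∈ I)
    (hx : x ∈ U) : point t x ∈ productDomain I U := ⟨ht, hx⟩

theorem hasFDerivAt_spacePart (p : Fin (n + 1) → ℝ) : HasFDerivAt (spacePart (n := n))
    (ContinuousLinearMap.pi fun i : Fin n =>
      ContinuousLinearMap.proj (R := ℝ) (φ := fun _ : Fin (n + 1) => ℝ) i.succ) p :=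
  hasFDerivAt_pi.2 fun i => hasFDerivAt_apply i.succ p

theorem hasFDerivAt_point (t : ℝ) (x : Fin n → ℝ) : HasFDerivAt (point t)
    (ContinuousLinearMap.pi fun a : Fin (n + 1) =>
      Fin.cases (motive := fun _ => (Fin n → ℝ) →L[ℝ] ℝ) 0
        (fun i => ContinuousLinearMap.proj (R := ℝ) (φ := fun _ : Fin n => ℝ) i) a) x := by
  refine hasFDerivAt_pi.2 fun a => ?_
  refine Fin.cases ?_ (fun i => ?_) a
  · exact hasFDerivAt_const t x
  · exact hasFDerivAt_apply i x

theorem contDiff_spacePart : ContDiff ℝ ∞ (spacePart (n := n)) :=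
  contDiff_pi.2 fun i => contDiff_apply ℝ ℝ i.succ

theorem contDiff_point (t : ℝ) : ContDiff ℝ ∞ (point (n := n) t) := by
  refine contDiff_pi.2 fun a => ?_
  refine Fin.cases ?_ (fun i => ?_) a
  · exact contDiff_const
  · exact contDiff_apply ℝ ℝ i

theorem smooth_spacePart {I : Set ℝ} {U : Set (Fin n → ℝ)} {f : (Fin n → ℝ) → ℝ}
    (hf : ContDiffOn ℝ ∞ f U) : ContDiffOn ℝ ∞ (fun p => f (spacePart p)) (productDomain I U) :=
  hf.comp contDiff_spacePart.contDiffOn fun _ hp => hp.2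

theorem smooth_slice {I : Set ℝ} {U : Set (Fin n → ℝ)} {f : (Fin (n + 1) → ℝ) → ℝ}
    (hf : ContDiffOn ℝ ∞ f (productDomain I U)) {t : ℝ} (ht : t ∈ I) :
    ContDiffOn ℝ ∞ (fun x => f (point t x)) U :=
  hf.comp (contDiff_point t).contDiffOn fun _ hx => ⟨ht, hx⟩

theorem smooth_time {s : Set (Fin (n + 1) → ℝ)} :
    ContDiffOn ℝ ∞ (fun p : Fin (n + 1) → ℝ => p 0) s :=
  (contDiff_apply ℝ ℝ (0 : Fin (n + 1))).contDiffOn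

theorem HasPD.comp_spacePart {f : (Fin n → ℝ) → ℝ} {j : Fin n} {p : Fin (n + 1) → ℝ} {d : ℝ}
    (h : HasPD f j (spacePart p) d) : HasPD (fun q => f (spacePart q)) j.succ p d := by
  have hf := h.1.hasFDerivAt.comp p (hasFDerivAt_spacePart p)
  refine ⟨hf.differentiableAt, ?_⟩
  rw [← h.2, pd]
  change fderiv ℝ (f ∘ spacePart) p _ = _
  rw [hf.fderiv, ContinuousLinearMap.comp_apply, pd]
  congr 1
  funext i
  simp [Pi.single_apply]

theorem HasPD.comp_spacePart_zero {f : (Fin n → ℝ) → ℝ} {p : Fin (n + 1) → ℝ}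
    (h : DifferentiableAt ℝ f (spacePart p)) : HasPD (fun q => f (spacePart q)) 0 p 0 := by
  have hf := h.hasFDerivAt.comp p (hasFDerivAt_spacePart p)
  refine ⟨hf.differentiableAt, ?_⟩
  rw [pd]
  change fderiv ℝ (f ∘ spacePart) p _ = _
  rw [hf.fderiv, ContinuousLinearMap.comp_apply]
  convert map_zero (fderiv ℝ f (spacePart p))
  funext i
  simp

theorem HasPD.time (p : Fin (n + 1) → ℝ) : HasPD (fun q => q 0) 0 p 1 := by
  have h := hasFDerivAt_apply (𝕜 := ℝ) (0 : Fin (n + 1)) p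
  refine ⟨h.differentiableAt, ?_⟩
  rw [pd, h.fderiv]
  simp

theorem HasPD.time_succ (p : Fin (n + 1) → ℝ) (j : Fin n) : HasPD (fun q => q 0) j.succ p 0 := by
  have h := hasFDerivAt_apply (𝕜 := ℝ) (0 : Fin (n + 1)) p
  refine ⟨h.differentiableAt, ?_⟩
  rw [pd, h.fderiv]
  simp

/-- The chain rule along the inclusion of the slice `t = p 0`; it transfers spatial derivatives on
the product to the `n`-space. -/
theorem pd_slice {f : (Fin (n + 1) → ℝ) → ℝ} {j : Fin n} {p : Fin (n + 1) → ℝ} {d : ℝ}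
    (h : HasPD f j.succ p d) : pd (fun x => f (point (p 0) x)) j (spacePart p) = d := by
  have hf := (h.1.hasFDerivAt : HasFDerivAt f _ p)
  rw [← point_spacePart p] at hf
  rw [pd]
  change fderiv ℝ (f ∘ point (p 0)) _ _ = _
  rw [(hf.comp (spacePart p) (hasFDerivAt_point (p 0) (spacePart p))).fderiv,
    ContinuousLinearMap.comp_apply, ← h.2, pd, point_spacePart]
  congr 1
  funext a
  refine Fin.cases ?_ (fun i => ?_) a
  · simp
  · simp [Pi.single_apply]

theorem isConnected_productDomain {I : Set ℝ} {U : Set (Fin n → ℝ)} (hI : IsConnected I)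
    (hU : IsConnected U) : IsConnected (productDomain I U) := by
  have h : productDomain I U = (fun q : ℝ × (Fin n → ℝ) => point q.1 q.2) '' (I ×ˢ U) := by
    ext p
    constructor
    · intro hp
      exact ⟨(p 0, spacePart p), ⟨hp.1, hp.2⟩, point_spacePart p⟩
    · rintro ⟨q, hq, rfl⟩
      exact ⟨hq.1, hq.2⟩
  rw [h]
  refine (hI.prod hU).image _ (Continuous.continuousOn (continuous_pi fun a => ?_))
  refine Fin.cases ?_ (fun i => ?_) a
  · exact continuous_fst
  · exact (continuous_apply i).comp continuous_snd

variable {ε : ℝ} {g : (Fin n → ℝ) → Matrix (Fin n) (Fin n) ℝ}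

@[simp] theorem productMetric_zero_zero (p : Fin (n + 1) → ℝ) : productMetric ε g p 0 0 = ε := rfl

@[simp] theorem productMetric_zero_succ (p : Fin (n + 1) → ℝ) (j : Fin n) :
    productMetric ε g p 0 j.succ = 0 := rfl

@[simp] theorem productMetric_succ_zero (p : Fin (n + 1) → ℝ) (j : Fin n) :
    productMetric ε g p j.succ 0 = 0 := rfl

@[simp] theorem productMetric_succ_succ (p : Fin (n + 1) → ℝ) (i j : Fin n) :
    productMetric ε g p i.succ j.succ = g (spacePart p) i j := rfl

variable {I : Set ℝ} {U : Set (Fin n → ℝ)}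

theorem productMetric_mul (hg : IsMetricOn U g) (hε : ε ≠ 0) {p : Fin (n + 1) → ℝ}
    (hp : p ∈ productDomain I U) :
    productMetric ε g p * productMetric ε⁻¹ (fun x => (g x)⁻¹) p = 1 := by
  have h : ∀ i j, ∑ k, g (spacePart p) i k * (g (spacePart p))⁻¹ k j = if i = j then 1 else 0 :=
    fun i j => by
      rw [← Matrix.mul_apply,
        Matrix.mul_nonsing_inv _ (isUnit_iff_ne_zero.2 (hg.nondeg (spacePart p) hp.2)),
        Matrix.one_apply]
  ext a b
  rw [Matrix.mul_apply, Fin.sum_univ_succ]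
  refine Fin.cases ?_ (fun i => ?_) a <;> refine Fin.cases ?_ (fun j => ?_) b
  · simp [hε]
  · simp [(Fin.succ_ne_zero j).symm]
  · simp
  · simp [Matrix.one_apply, h]

theorem productMetric_inv (hg : IsMetricOn U g) (hε : ε ≠ 0) {p : Fin (n + 1) → ℝ}
    (hp : p ∈ productDomain I U) :
    (productMetric ε g p)⁻¹ = productMetric ε⁻¹ (fun x => (g x)⁻¹) p :=
  Matrix.inv_eq_right_inv (productMetric_mul hg hε hp)

theorem isMetricOn_product (hg : IsMetricOn U g) (hε : ε ≠ 0) :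
    IsMetricOn (productDomain I U) (productMetric ε g) where
  smooth a b := by
    refine Fin.cases ?_ (fun i => ?_) a <;> refine Fin.cases ?_ (fun j => ?_) b
    · exact contDiffOn_const
    · exact contDiffOn_const
    · exact contDiffOn_const
    · exact smooth_spacePart (hg.smooth i j)
  symm p hp := by
    refine Matrix.IsSymm.ext fun a b => ?_
    refine Fin.cases ?_ (fun i => ?_) a <;> refine Fin.cases ?_ (fun j => ?_) b
    · rfl
    · rfl
    · rfl
    · exact hg.apply_comm hp.2 j i
  nondeg p hp :=
    (Matrix.isUnit_det_of_right_inverse (productMetric_mul hg hε hp)).ne_zero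

theorem pd_productMetric_left (b c : Fin (n + 1)) (p : Fin (n + 1) → ℝ) :
    pd (fun y => productMetric ε g y 0 b) c p = 0 := by
  refine Fin.cases ?_ (fun j => ?_) b <;> exact pd_const _ _ _

theorem pd_productMetric_right (a c : Fin (n + 1)) (p : Fin (n + 1) → ℝ) :
    pd (fun y => productMetric ε g y a 0) c p = 0 := by
  refine Fin.cases ?_ (fun j => ?_) a <;> exact pd_const _ _ _

theorem pd_metric_spacePart_time (hU : IsOpen U) (hg : IsMetricOn U g) {p : Fin (n + 1) → ℝ}
    (hp : p ∈ productDomain I U) (i j : Fin n) : pd (fun y => g (spacePart y) i j) 0 p = 0 :=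
  (HasPD.comp_spacePart_zero (HasPD.of_smooth hU (hg.smooth i j) i hp.2).1).eq

theorem pd_productMetric_time (hU : IsOpen U) (hg : IsMetricOn U g) {p : Fin (n + 1) → ℝ}
    (hp : p ∈ productDomain I U) (a b : Fin (n + 1)) :
    pd (fun y => productMetric ε g y a b) 0 p = 0 := by
  refine Fin.cases ?_ (fun i => ?_) a
  · exact pd_productMetric_left b 0 p
  refine Fin.cases ?_ (fun j => ?_) b
  · exact pd_productMetric_right _ 0 p
  · exact pd_metric_spacePart_time hU hg hp i j

theorem pd_metric_spacePart_succ (hU : IsOpen U) (hg : IsMetricOn U g) {p : Fin (n + 1) → ℝ}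
    (hp : p ∈ productDomain I U) (i j k : Fin n) :
    pd (fun y => g (spacePart y) i j) k.succ p = pd (fun x => g x i j) k (spacePart p) :=
  (HasPD.of_smooth hU (hg.smooth i j) k hp.2).comp_spacePart.eq

/-- The metric is block diagonal, `ε` is constant and `g` does not depend on `t`, so every
Christoffel symbol with an index `t` vanishes. This lemma and the next two treat the three positions
of that index. -/
theorem christoffel_product_zero (hU : IsOpen U) (hg : IsMetricOn U g) (hε : ε ≠ 0)
    {p : Fin (n + 1) → ℝ} (hp : p ∈ productDomain I U) (b c : Fin (n + 1)) :
    christoffel (productMetric ε g) 0 b c p = 0 := by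
  simp [christoffel, productMetric_inv hg hε hp, Fin.sum_univ_succ, pd_productMetric_left,
    pd_productMetric_time hU hg hp]

theorem christoffel_product_left (hU : IsOpen U) (hg : IsMetricOn U g) {p : Fin (n + 1) → ℝ}
    (hp : p ∈ productDomain I U) (a c : Fin (n + 1)) :
    christoffel (productMetric ε g) a 0 c p = 0 := by
  simp [christoffel, pd_productMetric_left, pd_productMetric_right, pd_productMetric_time hU hg hp]

theorem christoffel_product_right (hU : IsOpen U) (hg : IsMetricOn U g) {p : Fin (n + 1) → ℝ}
    (hp : p ∈ productDomain I U) (a b : Fin (n + 1)) :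
    christoffel (productMetric ε g) a b 0 p = 0 := by
  simp [christoffel, pd_productMetric_right, pd_productMetric_time hU hg hp]

theorem christoffel_product_succ (hU : IsOpen U) (hg : IsMetricOn U g) (hε : ε ≠ 0)
    {p : Fin (n + 1) → ℝ} (hp : p ∈ productDomain I U) (i j k : Fin n) :
    christoffel (productMetric ε g) i.succ j.succ k.succ p
      = christoffel g i j k (spacePart p) := by
  simp [christoffel, productMetric_inv hg hε hp, Fin.sum_univ_succ, pd_metric_spacePart_succ hU hg hp]

theorem hasPD_christoffel_time (hI : IsOpen I) (hU : IsOpen U) (hg : IsMetricOn U g) (hε : ε ≠ 0)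
    {p : Fin (n + 1) → ℝ} (hp : p ∈ productDomain I U) (a b c : Fin (n + 1)) :
    HasPD (christoffel (productMetric ε g) a b c) 0 p 0 := by
  have hM := isOpen_productDomain hI hU
  refine Fin.cases ?_ (fun i => ?_) a
  · exact (HasPD.const 0 0 p).congr hM (fun q hq => christoffel_product_zero hU hg hε hq b c) hp
  refine Fin.cases ?_ (fun j => ?_) b
  · exact (HasPD.const 0 0 p).congr hM (fun q hq => christoffel_product_left hU hg hq _ c) hp
  refine Fin.cases ?_ (fun k => ?_) c
  · exact (HasPD.const 0 0 p).congr hM (fun q hq => christoffel_product_right hU hg hq _ _) hp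
  · exact (HasPD.comp_spacePart_zero
      (HasPD.of_smooth hU (smooth_christoffel hU hg i j k) i hp.2).1).congr hM
      (fun q hq => christoffel_product_succ hU hg hε hq i j k) hp

theorem pd_christoffel_product_zero (hI : IsOpen I) (hU : IsOpen U) (hg : IsMetricOn U g)
    (hε : ε ≠ 0) {p : Fin (n + 1) → ℝ} (hp : p ∈ productDomain I U) (b c d : Fin (n + 1)) :
    pd (christoffel (productMetric ε g) 0 b c) d p = 0 :=
  ((HasPD.const 0 d p).congr (isOpen_productDomain hI hU)
    (fun _ hq => christoffel_product_zero hU hg hε hq b c) hp).eq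

theorem pd_christoffel_product_left (hI : IsOpen I) (hU : IsOpen U) (hg : IsMetricOn U g)
    {p : Fin (n + 1) → ℝ} (hp : p ∈ productDomain I U) (a c d : Fin (n + 1)) :
    pd (christoffel (productMetric ε g) a 0 c) d p = 0 :=
  ((HasPD.const 0 d p).congr (isOpen_productDomain hI hU)
    (fun _ hq => christoffel_product_left hU hg hq a c) hp).eq

theorem pd_christoffel_product_succ (hI : IsOpen I) (hU : IsOpen U) (hg : IsMetricOn U g)
    (hε : ε ≠ 0) {p : Fin (n + 1) → ℝ} (hp : p ∈ productDomain I U) (i j k l : Fin n) :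
    pd (christoffel (productMetric ε g) i.succ j.succ k.succ) l.succ p
      = pd (christoffel g i j k) l (spacePart p) :=
  ((HasPD.of_smooth hU (smooth_christoffel hU hg i j k) l hp.2).comp_spacePart.congr
    (isOpen_productDomain hI hU) (fun _ hq => christoffel_product_succ hU hg hε hq i j k) hp).eq

/-- The derivative `∂_t X` of a vector field on the decomposable space. -/
noncomputable def timeDeriv (X : (Fin (n + 1) → ℝ) → Fin (n + 1) → ℝ)
    (p : Fin (n + 1) → ℝ) (a : Fin (n + 1)) : ℝ :=
  pd (fun q => X q a) 0 p

/-- The vector field `X^i(t, ·) ∂_i` on the `n`-space. -/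
def spaceField (X : (Fin (n + 1) → ℝ) → Fin (n + 1) → ℝ) (t : ℝ) (x : Fin n → ℝ) (i : Fin n) : ℝ :=
  X (point t x) i.succ

variable {X : (Fin (n + 1) → ℝ) → Fin (n + 1) → ℝ}

theorem isVectorField_timeDeriv (hI : IsOpen I) (hU : IsOpen U)
    (hX : IsVectorField (productDomain I U) X) : IsVectorField (productDomain I U) (timeDeriv X) :=
  fun a => pd_smooth (isOpen_productDomain hI hU) (hX a) 0

theorem isVectorField_spaceField (hX : IsVectorField (productDomain I U) X) {t : ℝ} (ht : t ∈ I) :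
    IsVectorField U (spaceField X t) :=
  fun i => smooth_slice (hX i.succ) ht

theorem pd_spaceField (hI : IsOpen I) (hU : IsOpen U) (hX : IsVectorField (productDomain I U) X)
    {p : Fin (n + 1) → ℝ} (hp : p ∈ productDomain I U) (i j : Fin n) :
    pd (fun x => spaceField X (p 0) x i) j (spacePart p) = pd (fun q => X q i.succ) j.succ p :=
  pd_slice (HasPD.of_smooth (isOpen_productDomain hI hU) (hX i.succ) j.succ hp)

theorem spaceField_spacePart (p : Fin (n + 1) → ℝ) (i : Fin n) :
    spaceField X (p 0) (spacePart p) i = X p i.succ := by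
  rw [spaceField, point_spacePart]

theorem pd_pd_slice (hI : IsOpen I) (hU : IsOpen U) {f : (Fin (n + 1) → ℝ) → ℝ}
    (hf : ContDiffOn ℝ ∞ f (productDomain I U))
    {p : Fin (n + 1) → ℝ} (hp : p ∈ productDomain I U) (j k : Fin n) :
    pd (fun y => pd (fun x => f (point (p 0) x)) j y) k (spacePart p)
      = pd (pd f j.succ) k.succ p := by
  have hM := isOpen_productDomain hI hU
  rw [← pd_slice (HasPD.of_smooth hM (pd_smooth hM hf j.succ) k.succ hp)]
  exact pd_congr hU (fun y hy => pd_slice (p := point (p 0) y)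
    (HasPD.of_smooth hM hf j.succ (point_mem hp.1 hy))) k hp.2

/-! ### Components of the Lie derivatives and the Hessian on the product -/

theorem lieMetric_product_zero_zero {p : Fin (n + 1) → ℝ} :
    lieMetric (productMetric ε g) X 0 0 p = 2 * ε * pd (fun q => X q 0) 0 p := by
  simp [lieMetric, Fin.sum_univ_succ, pd_const]
  ring

theorem lieMetric_product_zero_succ {p : Fin (n + 1) → ℝ} (j : Fin n) :
    lieMetric (productMetric ε g) X 0 j.succ p = ε * pd (fun q => X q 0) j.succ p
      + ∑ k, g (spacePart p) k j * pd (fun q => X q k.succ) 0 p := by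
  simp [lieMetric, Fin.sum_univ_succ, pd_const]

theorem lieMetric_product_succ_zero {p : Fin (n + 1) → ℝ} (j : Fin n) :
    lieMetric (productMetric ε g) X j.succ 0 p = ε * pd (fun q => X q 0) j.succ p
      + ∑ k, g (spacePart p) j k * pd (fun q => X q k.succ) 0 p := by
  simp [lieMetric, Fin.sum_univ_succ, pd_const]

theorem lieMetric_product_succ_succ (hI : IsOpen I) (hU : IsOpen U) (hg : IsMetricOn U g)
    (hX : IsVectorField (productDomain I U) X) {p : Fin (n + 1) → ℝ}
    (hp : p ∈ productDomain I U) (i j : Fin n) :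
    lieMetric (productMetric ε g) X i.succ j.succ p
      = lieMetric g (spaceField X (p 0)) i j (spacePart p) := by
  simp [lieMetric, Fin.sum_univ_succ, pd_metric_spacePart_time hU hg hp,
    pd_metric_spacePart_succ hU hg hp, pd_spaceField hI hU hX hp, spaceField_spacePart]

theorem hessian_product_zero_left (hU : IsOpen U) (hg : IsMetricOn U g)
    {p : Fin (n + 1) → ℝ} (hp : p ∈ productDomain I U) (f : (Fin (n + 1) → ℝ) → ℝ)
    (b : Fin (n + 1)) : hessian (productMetric ε g) f 0 b p = pd (pd f 0) b p := by
  simp [hessian, christoffel_product_left hU hg hp]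

theorem hessian_product_zero_right (hU : IsOpen U) (hg : IsMetricOn U g)
    {p : Fin (n + 1) → ℝ} (hp : p ∈ productDomain I U) (f : (Fin (n + 1) → ℝ) → ℝ)
    (a : Fin (n + 1)) : hessian (productMetric ε g) f a 0 p = pd (pd f a) 0 p := by
  simp [hessian, christoffel_product_right hU hg hp]

theorem hessian_product_succ (hI : IsOpen I) (hU : IsOpen U) (hg : IsMetricOn U g) (hε : ε ≠ 0)
    {p : Fin (n + 1) → ℝ} (hp : p ∈ productDomain I U) {f : (Fin (n + 1) → ℝ) → ℝ}
    (hf : ContDiffOn ℝ ∞ f (productDomain I U)) (i j : Fin n) :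
    hessian (productMetric ε g) f i.succ j.succ p
      = hessian g (fun x => f (point (p 0) x)) i j (spacePart p) := by
  have hM := isOpen_productDomain hI hU
  rw [hessian, hessian, pd_pd_slice hI hU hf hp, Fin.sum_univ_succ,
    christoffel_product_zero hU hg hε hp]
  simp [christoffel_product_succ hU hg hε hp,
    pd_slice (HasPD.of_smooth hM hf _ hp)]

section LieConnection

theorem lieConnection_product_zero_zero (hI : IsOpen I) (hU : IsOpen U) (hg : IsMetricOn U g)
    (hε : ε ≠ 0) {p : Fin (n + 1) → ℝ} (hp : p ∈ productDomain I U) (c : Fin (n + 1)) :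
    lieConnection (productMetric ε g) X 0 0 c p = pd (pd (fun q => X q 0) 0) c p := by
  simp [lieConnection, christoffel_product_zero hU hg hε hp, christoffel_product_left hU hg hp,
    pd_christoffel_product_zero hI hU hg hε hp]

theorem lieConnection_product_zero_succ_zero (hI : IsOpen I) (hU : IsOpen U) (hg : IsMetricOn U g)
    (hε : ε ≠ 0) {p : Fin (n + 1) → ℝ} (hp : p ∈ productDomain I U) (b : Fin (n + 1)) :
    lieConnection (productMetric ε g) X 0 b 0 p = pd (pd (fun q => X q 0) b) 0 p := by
  simp [lieConnection, christoffel_product_zero hU hg hε hp, christoffel_product_right hU hg hp,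
    pd_christoffel_product_zero hI hU hg hε hp]

/-- With upper index `t`, the only surviving connection term is `-Γ^r_{ij} ∂_r X^0`, which completes
the second derivative of `X^0` to a Hessian. -/
theorem lieConnection_product_zero_succ_succ (hI : IsOpen I) (hU : IsOpen U)
    (hg : IsMetricOn U g) (hε : ε ≠ 0) (hX : IsVectorField (productDomain I U) X)
    {p : Fin (n + 1) → ℝ} (hp : p ∈ productDomain I U) (i j : Fin n) :
    lieConnection (productMetric ε g) X 0 i.succ j.succ p
      = hessian g (fun x => X (point (p 0) x) 0) i j (spacePart p) := by
  rw [← hessian_product_succ hI hU hg hε hp (hX 0)]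
  simp [lieConnection, hessian, christoffel_product_zero hU hg hε hp,
    pd_christoffel_product_zero hI hU hg hε hp, sub_eq_add_neg, mul_comm]

theorem lieConnection_product_succ_zero_zero (hI : IsOpen I) (hU : IsOpen U)
    (hg : IsMetricOn U g) {p : Fin (n + 1) → ℝ} (hp : p ∈ productDomain I U) (i : Fin n) :
    lieConnection (productMetric ε g) X i.succ 0 0 p = pd (pd (fun q => X q i.succ) 0) 0 p := by
  simp [lieConnection, christoffel_product_left hU hg hp, christoffel_product_right hU hg hp,
    pd_christoffel_product_left hI hU hg hp]

/-- What survives is `∂_j ∂_t X^i + Γ^i_{rj} ∂_t X^r`, the covariant derivative of the slice of `∂_t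
X`. -/
theorem lieConnection_product_succ_zero_succ (hI : IsOpen I) (hU : IsOpen U)
    (hg : IsMetricOn U g) (hε : ε ≠ 0) (hX : IsVectorField (productDomain I U) X)
    {p : Fin (n + 1) → ℝ} (hp : p ∈ productDomain I U) (i j : Fin n) :
    lieConnection (productMetric ε g) X i.succ 0 j.succ p
      = covDeriv g (spaceField (timeDeriv X) (p 0)) i j (spacePart p) := by
  rw [covDeriv, pd_spaceField hI hU (isVectorField_timeDeriv hI hU hX) hp]
  simp [lieConnection, christoffel_product_left hU hg hp, Fin.sum_univ_succ,
    pd_christoffel_product_left hI hU hg hp, christoffel_product_succ hU hg hε hp,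
    spaceField_spacePart, timeDeriv, mul_comm]

theorem lieConnection_product_succ_succ_zero (hI : IsOpen I) (hU : IsOpen U)
    (hg : IsMetricOn U g) (hε : ε ≠ 0) (hX : IsVectorField (productDomain I U) X)
    {p : Fin (n + 1) → ℝ} (hp : p ∈ productDomain I U) (i j : Fin n) :
    lieConnection (productMetric ε g) X i.succ j.succ 0 p
      = covDeriv g (spaceField (timeDeriv X) (p 0)) i j (spacePart p) := by
  rw [lieConnection_comm (isOpen_productDomain hI hU) (isMetricOn_product hg hε) hX hp,
    lieConnection_product_succ_zero_succ hI hU hg hε hX hp]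

theorem lieConnection_product_succ (hI : IsOpen I) (hU : IsOpen U)
    (hg : IsMetricOn U g) (hε : ε ≠ 0) (hX : IsVectorField (productDomain I U) X)
    {p : Fin (n + 1) → ℝ} (hp : p ∈ productDomain I U) (i j k : Fin n) :
    lieConnection (productMetric ε g) X i.succ j.succ k.succ p
      = lieConnection g (spaceField X (p 0)) i j k (spacePart p) := by
  have h := pd_pd_slice hI hU (hX i.succ) hp j k
  simp only [lieConnection, pd_spaceField hI hU hX hp, spaceField_spacePart]
  rw [show pd (fun y => pd (fun z => spaceField X (p 0) z i) j y) k (spacePart p) = _ from h,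
    Fin.sum_univ_succ]
  simp [christoffel_product_left hU hg hp, christoffel_product_right hU hg hp,
    christoffel_product_zero hU hg hε hp, christoffel_product_succ hU hg hε hp,
    pd_christoffel_product_succ hI hU hg hε hp,
    (hasPD_christoffel_time hI hU hg hε hp _ _ _).eq]

end LieConnection

/-- `∂_t` commutes with the Lie derivative of the connection. -/
theorem lieConnection_timeDeriv (hI : IsOpen I) (hU : IsOpen U)
    (hg : IsMetricOn U g) (hε : ε ≠ 0) (hX : IsVectorField (productDomain I U) X)
    {p : Fin (n + 1) → ℝ} (hp : p ∈ productDomain I U) (a b c : Fin (n + 1)) :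
    lieConnection (productMetric ε g) (timeDeriv X) a b c p
      = pd (lieConnection (productMetric ε g) X a b c) 0 p := by
  have hM := isOpen_productDomain hI hU
  have hG := isMetricOn_product (I := I) hg hε
  have hΓ := hasPD_christoffel_time hI hU hg hε hp
  -- Derivatives of `Γ` are independent of `t` too: commute `∂_t` inwards and use that `Γ` is.
  have hdΓ : ∀ a b c d, HasPD (pd (christoffel (productMetric ε g) a b c) d) 0 p 0 := by
    intro a b c d
    have h := HasPD.of_smooth hM (pd_smooth hM (smooth_christoffel hM hG a b c) d) 0 hp
    rwa [pd_comm hM (smooth_christoffel hM hG a b c) d 0 hp,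
      pd_congr hM (fun q hq => (hasPD_christoffel_time hI hU hg hε hq a b c).eq) d hp,
      pd_const] at h
  have hV : ∀ d, HasPD (fun q => X q d) 0 p (timeDeriv X p d) := fun d =>
    .of_smooth hM (hX d) 0 hp
  have hVV : ∀ d e, HasPD (pd (fun q => X q d) e) 0 p (pd (fun q => timeDeriv X q d) e p) := by
    intro d e
    have h := HasPD.of_smooth hM (pd_smooth hM (hX d) e) 0 hp
    rwa [pd_comm hM (hX d) e 0 hp] at h
  have hVVV : HasPD (pd (pd (fun q => X q a) b) c) 0 p
      (pd (pd (fun q => timeDeriv X q a) b) c p) := by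
    have h := HasPD.of_smooth hM (pd_smooth hM (pd_smooth hM (hX a) b) c) 0 hp
    rwa [pd_comm hM (pd_smooth hM (hX a) b) c 0 hp,
      pd_congr hM (fun q hq => pd_comm hM (hX a) b 0 hq) c hp] at h
  have h : pd (lieConnection (productMetric ε g) X a b c) 0 p = _ :=
    (hVVV.add (HasPD.sum (s := Finset.univ) fun r _ =>
      ((((hV r).mul (hdΓ a b c r)).sub ((hVV a r).mul (hΓ r b c))).add
        ((hVV r b).mul (hΓ a r c))).add ((hVV r c).mul (hΓ a b r)))).eq
  rw [h]
  simp [lieConnection]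

/-- `∂_t` commutes with the Lie derivative of the metric. -/
theorem lieMetric_timeDeriv (hI : IsOpen I) (hU : IsOpen U)
    (hg : IsMetricOn U g) (hε : ε ≠ 0) (hX : IsVectorField (productDomain I U) X)
    {p : Fin (n + 1) → ℝ} (hp : p ∈ productDomain I U) (a b : Fin (n + 1)) :
    lieMetric (productMetric ε g) (timeDeriv X) a b p
      = pd (lieMetric (productMetric ε g) X a b) 0 p := by
  have hM := isOpen_productDomain hI hU
  have hG := isMetricOn_product (I := I) hg hε
  have hΓ : ∀ a b, HasPD (fun y => productMetric ε g y a b) 0 p 0 := fun a b => by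
    have h := HasPD.of_smooth hM (hG.smooth a b) 0 hp
    rwa [pd_productMetric_time hU hg hp] at h
  have hdΓ : ∀ a b d, HasPD (pd (fun y => productMetric ε g y a b) d) 0 p 0 := by
    intro a b d
    have h := HasPD.of_smooth hM (pd_smooth hM (hG.smooth a b) d) 0 hp
    rwa [pd_comm hM (hG.smooth a b) d 0 hp,
      pd_congr hM (fun q hq => pd_productMetric_time hU hg hq a b) d hp,
      pd_const] at h
  have hV : ∀ d, HasPD (fun q => X q d) 0 p (timeDeriv X p d) := fun d =>
    .of_smooth hM (hX d) 0 hp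
  have hVV : ∀ d e, HasPD (pd (fun q => X q d) e) 0 p (pd (fun q => timeDeriv X q d) e p) := by
    intro d e
    have h := HasPD.of_smooth hM (pd_smooth hM (hX d) e) 0 hp
    rwa [pd_comm hM (hX d) e 0 hp] at h
  have h : pd (lieMetric (productMetric ε g) X a b) 0 p = _ :=
    (HasPD.sum (s := Finset.univ) fun r _ => (((hV r).mul (hdΓ a b r)).add
      ((hΓ r b).mul (hVV r a))).add ((hΓ a r).mul (hVV r b))).eq
  rw [h]
  simp [lieMetric]

end Product

/-! ### The projective equations on the product -/

section Collineations

variable {n : ℕ} {ε : ℝ} {g : (Fin n → ℝ) → Matrix (Fin n) (Fin n) ℝ} {I : Set ℝ}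
  {U : Set (Fin n → ℝ)} {X : (Fin (n + 1) → ℝ) → Fin (n + 1) → ℝ}
  {w : (Fin (n + 1) → ℝ) → Fin (n + 1) → ℝ}

/-- `X` is a projective collineation with one-form `w`. -/
def IsProjectiveWith {m : ℕ} (U : Set (Fin m → ℝ)) (g : (Fin m → ℝ) → Matrix (Fin m) (Fin m) ℝ)
    (X w : (Fin m → ℝ) → Fin m → ℝ) : Prop :=
  IsVectorField U X ∧ IsVectorField U w ∧ ∀ x ∈ U, ∀ i j k, lieConnection g X i j k x
    = (if i = k then w x j else 0) + (if i = j then w x k else 0)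

theorem isProjective_iff {m : ℕ} {U : Set (Fin m → ℝ)}
    {g : (Fin m → ℝ) → Matrix (Fin m) (Fin m) ℝ} {X : (Fin m → ℝ) → Fin m → ℝ} :
    IsProjective U g X ↔ ∃ w, IsProjectiveWith U g X w :=
  ⟨fun ⟨hX, w, hw, h⟩ => ⟨w, hX, hw, h⟩, fun ⟨w, hX, hw, h⟩ => ⟨hX, w, hw, h⟩⟩

namespace IsProjectiveWith

/-- The coefficients of the Lie derivative of `Γ` do not depend on `t`, so the projective equation
may be differentiated in `t`. This supplies a second set of component equations. -/
theorem timeDeriv (hI : IsOpen I) (hU : IsOpen U) (hg : IsMetricOn U g) (hε : ε ≠ 0)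
    (h : IsProjectiveWith (productDomain I U) (productMetric ε g) X w) :
    IsProjectiveWith (productDomain I U) (productMetric ε g) (timeDeriv X)
      (DecomposableSpace.timeDeriv w) := by
  obtain ⟨hX, hw, h⟩ := h
  have hM := isOpen_productDomain hI hU
  refine ⟨isVectorField_timeDeriv hI hU hX, isVectorField_timeDeriv hI hU hw,
    fun p hp a b c => ?_⟩
  rw [lieConnection_timeDeriv hI hU hg hε hX hp, pd_congr hM (fun q hq => h q hq a b c) 0 hp]
  have hwd : ∀ (P : Prop) [Decidable P] (d : Fin (n + 1)),
      HasPD (fun q => if P then w q d else 0) 0 p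
        (if P then DecomposableSpace.timeDeriv w p d else 0) := by
    intro P _ d
    split_ifs
    · exact HasPD.of_smooth hM (hw d) 0 hp
    · exact HasPD.const 0 0 p
  exact ((hwd _ _).add (hwd _ _)).eq

/-- Both delta terms contribute when all three indices are `t`, hence the factor two; with one
spatial lower index only one of them does. -/
theorem time_time (hI : IsOpen I) (hU : IsOpen U) (hg : IsMetricOn U g) (hε : ε ≠ 0)
    (h : IsProjectiveWith (productDomain I U) (productMetric ε g) X w)
    {p : Fin (n + 1) → ℝ} (hp : p ∈ productDomain I U) :
    pd (pd (fun q => X q 0) 0) 0 p = 2 * w p 0 := by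
  have h1 := h.2.2 p hp 0 0 0
  rw [lieConnection_product_zero_zero hI hU hg hε hp] at h1
  simp only [if_true] at h1
  linarith

theorem time_space (hI : IsOpen I) (hU : IsOpen U) (hg : IsMetricOn U g) (hε : ε ≠ 0)
    (h : IsProjectiveWith (productDomain I U) (productMetric ε g) X w)
    {p : Fin (n + 1) → ℝ} (hp : p ∈ productDomain I U) (j : Fin n) :
    pd (pd (fun q => X q 0) 0) j.succ p = w p j.succ := by
  have h1 := h.2.2 p hp 0 0 j.succ
  rw [lieConnection_product_zero_zero hI hU hg hε hp] at h1
  simpa [(Fin.succ_ne_zero j).symm] using h1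

theorem hessian_time (hI : IsOpen I) (hU : IsOpen U) (hg : IsMetricOn U g) (hε : ε ≠ 0)
    (h : IsProjectiveWith (productDomain I U) (productMetric ε g) X w)
    {p : Fin (n + 1) → ℝ} (hp : p ∈ productDomain I U) (i j : Fin n) :
    hessian g (fun x => X (point (p 0) x) 0) i j (spacePart p) = 0 := by
  have h1 := h.2.2 p hp 0 i.succ j.succ
  rw [lieConnection_product_zero_succ_succ hI hU hg hε h.1 hp] at h1
  simpa [(Fin.succ_ne_zero i).symm, (Fin.succ_ne_zero j).symm] using h1

theorem space_time_time (hI : IsOpen I) (hU : IsOpen U) (hg : IsMetricOn U g)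
    (h : IsProjectiveWith (productDomain I U) (productMetric ε g) X w)
    {p : Fin (n + 1) → ℝ} (hp : p ∈ productDomain I U) (i : Fin n) :
    pd (pd (fun q => X q i.succ) 0) 0 p = 0 := by
  have h1 := h.2.2 p hp i.succ 0 0
  rw [lieConnection_product_succ_zero_zero hI hU hg hp] at h1
  simpa using h1

theorem covDeriv_timeDeriv (hI : IsOpen I) (hU : IsOpen U) (hg : IsMetricOn U g) (hε : ε ≠ 0)
    (h : IsProjectiveWith (productDomain I U) (productMetric ε g) X w)
    {p : Fin (n + 1) → ℝ} (hp : p ∈ productDomain I U) (i j : Fin n) :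
    covDeriv g (spaceField (DecomposableSpace.timeDeriv X) (p 0)) i j (spacePart p)
      = if i = j then w p 0 else 0 := by
  have h1 := h.2.2 p hp i.succ 0 j.succ
  rw [lieConnection_product_succ_zero_succ hI hU hg hε h.1 hp] at h1
  simpa using h1

theorem lieConnection_spaceField (hI : IsOpen I) (hU : IsOpen U) (hg : IsMetricOn U g)
    (hε : ε ≠ 0) (h : IsProjectiveWith (productDomain I U) (productMetric ε g) X w)
    {p : Fin (n + 1) → ℝ} (hp : p ∈ productDomain I U) (i j k : Fin n) :
    lieConnection g (spaceField X (p 0)) i j k (spacePart p)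
      = (if i = k then w p j.succ else 0) + (if i = j then w p k.succ else 0) := by
  have h1 := h.2.2 p hp i.succ j.succ k.succ
  rw [lieConnection_product_succ hI hU hg hε h.1 hp] at h1
  simpa using h1

/-- The component `w_0` of the one-form of a projective collineation is constant. -/
theorem exists_const (hn : 1 ≤ n) (hI : IsOpen I) (hIc : IsConnected I) (hU : IsOpen U)
    (hUc : IsConnected U) (hg : IsMetricOn U g) (hε : ε ≠ 0)
    (h : IsProjectiveWith (productDomain I U) (productMetric ε g) X w) :
    ∃ c, ∀ p ∈ productDomain I U, w p 0 = c := by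
  have hM := isOpen_productDomain hI hU
  have hMc := isConnected_productDomain hIc hUc
  have h' := h.timeDeriv hI hU hg hε
  obtain ⟨p₀, hp₀⟩ := hMc.nonempty
  refine ⟨w p₀ 0, fun p hp => eq_of_pd_eq_zero hM hMc (h.2.1 0) (fun q hq a => ?_) hp hp₀⟩
  refine Fin.cases ?_ (fun k => ?_) a
  -- Time direction: the equation for `∂_t X` expresses `∂_t w_0` through the covariant derivative
  -- of `∂_t² X^i`, which vanishes. A diagonal component is read off, and `1 ≤ n` provides one.
  · have h1 := h'.covDeriv_timeDeriv hI hU hg hε hq ⟨0, hn⟩ ⟨0, hn⟩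
    have h2 : ∀ x ∈ U, ∀ i, spaceField (DecomposableSpace.timeDeriv
        (DecomposableSpace.timeDeriv X)) (q 0) x i = 0 := fun x hx i =>
      h.space_time_time hI hU hg (point_mem hq.1 hx) i
    have hqU : spacePart q ∈ U := hq.2
    rw [covDeriv, pd_congr hU (fun x hx => h2 x hx _) _ hqU, pd_const] at h1
    simp only [h2 _ hqU, mul_zero, Finset.sum_const_zero, add_zero, if_true] at h1
    exact h1.symm
  · have hρ := smooth_slice (h.2.1 0) hq.1
    have hs : ∀ j : Fin n, pd (fun x => w (point (q 0) x) 0) j (spacePart q)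
        = pd (fun r => w r 0) j.succ q := fun j =>
      pd_slice (HasPD.of_smooth hM (h.2.1 0) j.succ hq)
    have hqU : spacePart q ∈ U := hq.2
    rw [← hs]
    refine pd_eq_zero_of_concircular hU hg
      (isVectorField_spaceField (isVectorField_timeDeriv hI hU h.1) hq.1) hρ
      (fun x hx i j => h.covDeriv_timeDeriv hI hU hg hε (point_mem hq.1 hx) i j) hqU
      (fun i j l => ?_) k
    -- Spatial directions: `∂_t w_j = ∂_t ∂_j ∂_t ξ = ∂_j (2 w_0)`, which is the one-form required
    -- by `pd_eq_zero_of_concircular`.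
    have h3 : ∀ j : Fin n, DecomposableSpace.timeDeriv w q j.succ
        = 2 * pd (fun r => w r 0) j.succ q := by
      intro j
      have hX := pd_smooth hM (h.1 0) 0
      rw [DecomposableSpace.timeDeriv, ← pd_congr hM (fun r hr => h.time_space hI hU hg hε hr j) 0
        hq]
      change pd (pd (pd (fun q => X q 0) 0) j.succ) 0 q = _
      rw [pd_comm hM hX j.succ 0 hq,
        pd_congr hM (fun r hr => h.time_time hI hU hg hε hr) j.succ hq]
      exact ((HasPD.of_smooth hM (h.2.1 0) j.succ hq).const_mul 2).eq
    rw [h'.lieConnection_spaceField hI hU hg hε hq, h3, h3, hs, hs]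

/-- Every projective collineation of the decomposable space is special. -/
theorem isSpecialProjective (hn : 1 ≤ n) (hI : IsOpen I) (hIc : IsConnected I) (hU : IsOpen U)
    (hUc : IsConnected U) (hg : IsMetricOn U g) (hε : ε ≠ 0)
    (h : IsProjectiveWith (productDomain I U) (productMetric ε g) X w) :
    IsSpecialProjective (productDomain I U) (productMetric ε g) X := by
  have hM := isOpen_productDomain hI hU
  obtain ⟨c, hc⟩ := h.exists_const hn hI hIc hU hUc hg hε
  have hX := pd_smooth hM (h.1 0) 0
  -- `∂_t ξ` has the right spatial derivatives but its time derivative is `2 w_0 = 2 c`; subtracting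
  -- `c t` corrects it to `w_0`.
  set φ : (Fin (n + 1) → ℝ) → ℝ := fun p => pd (fun q => X q 0) 0 p - c * p 0 with hφ
  have hφs : ContDiffOn ℝ ∞ φ (productDomain I U) :=
    hX.sub (contDiffOn_const.mul smooth_time)
  have h0 : ∀ p ∈ productDomain I U, pd φ 0 p = w p 0 := by
    intro p hp
    have h1 := ((HasPD.of_smooth hM hX 0 hp).sub ((HasPD.time p).const_mul c)).eq
    rw [h.time_time hI hU hg hε hp] at h1
    rw [hφ, h1, hc p hp]
    ring
  have hs : ∀ p ∈ productDomain I U, ∀ j : Fin n,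
      pd φ j.succ p = pd (pd (fun q => X q 0) 0) j.succ p := by
    intro p hp j
    have h1 := ((HasPD.of_smooth hM hX j.succ hp).sub ((HasPD.time_succ p j).const_mul c)).eq
    rw [hφ, h1]
    ring
  have hw : ∀ p ∈ productDomain I U, ∀ a, pd φ a p = w p a := by
    intro p hp a
    refine Fin.cases (h0 p hp) (fun j => ?_) a
    rw [hs p hp, h.time_space hI hU hg hε hp]
  have h0c : ∀ p ∈ productDomain I U, ∀ a, pd (pd φ 0) a p = 0 := by
    intro p hp a
    rw [pd_congr hM (fun q hq => (h0 q hq).trans (hc q hq)) a hp, pd_const]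
  refine ⟨h.1, φ, hφs, fun p hp i j k => ?_, fun p hp a b => ?_⟩
  · rw [h.2.2 p hp, hw p hp, hw p hp]
  refine Fin.cases ?_ (fun i => ?_) a
  · rw [hessian_product_zero_left hU hg hp, h0c p hp]
  refine Fin.cases ?_ (fun j => ?_) b
  · rw [hessian_product_zero_right hU hg hp, pd_comm hM hφs _ _ hp, h0c p hp]
  -- The term `c t` does not affect spatial derivatives, and `∂_t ξ` is the time component of the
  -- projective field `∂_t X`, hence has zero Hessian on slices.
  · have h1 := (h.timeDeriv hI hU hg hε).hessian_time hI hU hg hε hp i j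
    have h2 : hessian (productMetric ε g) φ i.succ j.succ p
        = hessian (productMetric ε g) (fun q => DecomposableSpace.timeDeriv X q 0) i.succ j.succ
          p := by
      unfold hessian
      rw [pd_congr hM (fun q hq => hs q hq i) j.succ hp]
      congr 1
      rw [Fin.sum_univ_succ, Fin.sum_univ_succ, christoffel_product_zero hU hg hε hp]
      simp only [hs p hp, zero_mul]
      rfl
    rw [h2, hessian_product_succ hI hU hg hε hp (isVectorField_timeDeriv hI hU h.1 0), h1]

end IsProjectiveWith

/-- The components that characterize a projective collineation of the decomposable space. -/
theorem isProjectiveWith_of_components (hI : IsOpen I) (hU : IsOpen U) (hg : IsMetricOn U g)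
    (hε : ε ≠ 0) (hX : IsVectorField (productDomain I U) X)
    (hw : IsVectorField (productDomain I U) w)
    (h00 : ∀ p ∈ productDomain I U, pd (pd (fun q => X q 0) 0) 0 p = 2 * w p 0)
    (h0s : ∀ p ∈ productDomain I U, ∀ j : Fin n,
      pd (pd (fun q => X q 0) 0) j.succ p = w p j.succ)
    (hh : ∀ p ∈ productDomain I U, ∀ i j,
      hessian g (fun x => X (point (p 0) x) 0) i j (spacePart p) = 0)
    (hs : ∀ p ∈ productDomain I U, ∀ i : Fin n, pd (pd (fun q => X q i.succ) 0) 0 p = 0)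
    (hc : ∀ p ∈ productDomain I U, ∀ i j,
      covDeriv g (spaceField (timeDeriv X) (p 0)) i j (spacePart p) = if i = j then w p 0 else 0)
    (hL : ∀ p ∈ productDomain I U, ∀ i j k,
      lieConnection g (spaceField X (p 0)) i j k (spacePart p)
        = (if i = k then w p j.succ else 0) + (if i = j then w p k.succ else 0)) :
    IsProjectiveWith (productDomain I U) (productMetric ε g) X w := by
  have hM := isOpen_productDomain hI hU
  refine ⟨hX, hw, fun p hp a b c => ?_⟩
  refine Fin.cases ?_ (fun i => ?_) a <;> refine Fin.cases ?_ (fun j => ?_) b <;>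
    refine Fin.cases ?_ (fun k => ?_) c
  · rw [lieConnection_product_zero_zero hI hU hg hε hp, h00 p hp]
    simp only [if_true]
    ring
  · rw [lieConnection_product_zero_zero hI hU hg hε hp, h0s p hp]
    simp [(Fin.succ_ne_zero k).symm]
  · rw [lieConnection_product_zero_succ_zero hI hU hg hε hp, pd_comm hM (hX 0) _ _ hp, h0s p hp]
    simp [(Fin.succ_ne_zero j).symm]
  · rw [lieConnection_product_zero_succ_succ hI hU hg hε hX hp, hh p hp]
    simp [(Fin.succ_ne_zero j).symm, (Fin.succ_ne_zero k).symm]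
  · rw [lieConnection_product_succ_zero_zero hI hU hg hp, hs p hp]
    simp
  · rw [lieConnection_product_succ_zero_succ hI hU hg hε hX hp, hc p hp]
    simp
  · rw [lieConnection_product_succ_succ_zero hI hU hg hε hX hp, hc p hp]
    simp
  · rw [lieConnection_product_succ hI hU hg hε hX hp, hL p hp]
    simp

end Collineations

/-! ### Linearity and locality of the operators -/

section Fields

variable {m : ℕ} {U : Set (Fin m → ℝ)} {g : (Fin m → ℝ) → Matrix (Fin m) (Fin m) ℝ}
  {X Y : (Fin m → ℝ) → Fin m → ℝ}

theorem lieMetric_smul (hU : IsOpen U) (hX : IsVectorField U X) (c : ℝ) {x : Fin m → ℝ}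
    (hx : x ∈ U) (i j : Fin m) : lieMetric g (c • X) i j x = c * lieMetric g X i j x := by
  have h : ∀ a b, pd (fun y => c * X y a) b x = c * pd (fun y => X y a) b x := fun a b =>
    ((HasPD.of_smooth hU (hX a) b hx).const_mul c).eq
  simp only [lieMetric, Finset.mul_sum, Pi.smul_apply, smul_eq_mul, h]
  refine Finset.sum_congr rfl fun k _ => ?_
  ring

theorem lieConnection_zero (i j k : Fin m) (x : Fin m → ℝ) : lieConnection g 0 i j k x = 0 := by
  simp [lieConnection, pd]

theorem lieConnection_smul (hU : IsOpen U) (hX : IsVectorField U X) (c : ℝ) {x : Fin m → ℝ}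
    (hx : x ∈ U) (i j k : Fin m) :
    lieConnection g (c • X) i j k x = c * lieConnection g X i j k x := by
  have h := lieConnection_combo hU g hX (Y := 0) (fun _ => contDiffOn_const) c i j k hx
  rwa [add_zero, lieConnection_zero, add_zero] at h

theorem lieConnection_congr (hU : IsOpen U) (h : ∀ x ∈ U, X x = Y x) {x : Fin m → ℝ} (hx : x ∈ U)
    (i j k : Fin m) : lieConnection g X i j k x = lieConnection g Y i j k x := by
  have h1 : ∀ a b, ∀ y ∈ U, pd (fun z => X z a) b y = pd (fun z => Y z a) b y := fun a b y hy =>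
    pd_congr hU (fun z hz => congrFun (h z hz) a) b hy
  simp only [lieConnection, h1 _ _ x hx, h x hx]
  rw [pd_congr hU (h1 i j) k hx]

theorem covDeriv_congr (hU : IsOpen U) (h : ∀ x ∈ U, X x = Y x) {x : Fin m → ℝ} (hx : x ∈ U)
    (i j : Fin m) : covDeriv g X i j x = covDeriv g Y i j x := by
  simp only [covDeriv, h x hx]
  rw [pd_congr hU (fun z hz => congrFun (h z hz) i) j hx]

theorem isProjective_congr (hU : IsOpen U) (h : ∀ x ∈ U, X x = Y x) (hY : IsProjective U g Y) :
    IsProjective U g X := by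
  obtain ⟨hY, w, hw, hL⟩ := hY
  exact ⟨fun i => (hY i).congr fun x hx => congrFun (h x hx) i, w, hw, fun x hx i j k => by
    rw [lieConnection_congr hU h hx, hL x hx]⟩

theorem hessian_const_mul (hU : IsOpen U) {f : (Fin m → ℝ) → ℝ} (hf : ContDiffOn ℝ ∞ f U)
    (c d : ℝ) {x : Fin m → ℝ} (hx : x ∈ U) (i j : Fin m) :
    hessian g (fun y => d + c * f y) i j x = c * hessian g f i j x := by
  have h : ∀ k, ∀ y ∈ U, pd (fun y => d + c * f y) k y = c * pd f k y := fun k y hy => by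
    rw [((HasPD.const d k y).add ((HasPD.of_smooth hU hf k hy).const_mul c)).eq, zero_add]
  simp only [hessian, h _ x hx]
  rw [pd_congr hU (h i) j hx, ((HasPD.of_smooth hU (pd_smooth hU hf i) j hx).const_mul c).eq,
    mul_sub, Finset.mul_sum]
  congr 1
  refine Finset.sum_congr rfl fun k _ => ?_
  ring

end Fields

/-! ### Homothetic vectors, proper collineations and rotations -/

section Results

variable {n : ℕ} {ε : ℝ} {g : (Fin n → ℝ) → Matrix (Fin n) (Fin n) ℝ} {I : Set ℝ}
  {U : Set (Fin n → ℝ)}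

theorem isVectorField_point {s : Set (Fin (n + 1) → ℝ)} {ξ : (Fin (n + 1) → ℝ) → ℝ}
    {η : (Fin (n + 1) → ℝ) → Fin n → ℝ} (hξ : ContDiffOn ℝ ∞ ξ s)
    (hη : ∀ i, ContDiffOn ℝ ∞ (fun p => η p i) s) :
    IsVectorField s (fun p => point (ξ p) (η p)) := fun a => by
  refine Fin.cases ?_ (fun i => ?_) a
  · exact hξ
  · exact hη i

/-- A homothetic field restricts to any slice with the same factor, since the spatial block of the
equation involves only the slice. Conversely `Y` extends to `ψ t ∂_t + Y`. -/
theorem homothetic_product_iff (hI : IsOpen I) (hIn : I.Nonempty) (hU : IsOpen U)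
    (hg : IsMetricOn U g) :
    (∃ X, IsHomothetic (productDomain I U) (productMetric ε g) X) ↔ ∃ Y, IsHomothetic U g Y := by
  constructor
  · rintro ⟨X, hX, ψ, hψ, h⟩
    obtain ⟨t, ht⟩ := hIn
    refine ⟨spaceField X t, isVectorField_spaceField hX ht, ψ, hψ, fun x hx i j => ?_⟩
    have h1 := h (point t x) (point_mem ht hx) i.succ j.succ
    rw [lieMetric_product_succ_succ hI hU hg hX (point_mem ht hx)] at h1
    exact h1
  · rintro ⟨Y, hY, ψ, hψ, h⟩
    have hX : IsVectorField (productDomain I U) (fun p => point (ψ * p 0) (Y (spacePart p))) :=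
      isVectorField_point (contDiffOn_const.mul smooth_time) fun i => smooth_spacePart (hY i)
    refine ⟨_, hX, ψ, hψ, fun p hp a b => ?_⟩
    have h1 : ∀ k : Fin n, pd (fun q => Y (spacePart q) k) 0 p = 0 := fun k =>
      (HasPD.comp_spacePart_zero (HasPD.of_smooth hU (hY k) k hp.2).1).eq
    refine Fin.cases ?_ (fun i => ?_) a <;> refine Fin.cases ?_ (fun j => ?_) b
    · rw [lieMetric_product_zero_zero]
      simp only [point_zero, ((HasPD.time p).const_mul ψ).eq, productMetric_zero_zero]
      ring
    · rw [lieMetric_product_zero_succ]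
      simp [((HasPD.time_succ p j).const_mul ψ).eq, h1]
    · rw [lieMetric_product_succ_zero]
      simp [((HasPD.time_succ p i).const_mul ψ).eq, h1]
    · rw [lieMetric_product_succ_succ hI hU hg hX hp]
      exact h _ hp.2 i j

/-- The field `ψ t² ∂_t + t Y` works with one-form `ψ dt`: the slice of its time derivative is `Y`,
for which `Y^i_{;j} = ψ δ^i_j` because `Y` is a gradient, and its own slices are multiples of `Y`,
which preserve the connection. -/
theorem exists_properProjective (hI : IsOpen I) (hIn : I.Nonempty) (hU : IsOpen U)
    (hUn : U.Nonempty) (hg : IsMetricOn U g) (hε : ε ≠ 0) {Y : (Fin n → ℝ) → Fin n → ℝ}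
    (hY : IsHomothetic U g Y) (hYg : IsGradient U g Y) :
    ∃ X, IsProperProjective (productDomain I U) (productMetric ε g) X := by
  have hM := isOpen_productDomain hI hU
  obtain ⟨hYv, ψ, hψ, hl⟩ := hY
  obtain ⟨t₀, ht₀⟩ := hIn
  obtain ⟨x₀, hx₀⟩ := hUn
  set X : (Fin (n + 1) → ℝ) → Fin (n + 1) → ℝ := fun p =>
    point (ψ * (p 0 * p 0)) (fun i => p 0 * Y (spacePart p) i) with hXdef
  have hX : IsVectorField (productDomain I U) X :=
    isVectorField_point (contDiffOn_const.mul (smooth_time.mul smooth_time))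
      fun i => smooth_time.mul (smooth_spacePart (hYv i))
  have hY0 : ∀ p ∈ productDomain I U, ∀ i : Fin n, HasPD (fun q => Y (spacePart q) i) 0 p 0 :=
    fun p hp i => HasPD.comp_spacePart_zero (HasPD.of_smooth hU (hYv i) i hp.2).1
  have hξ0 : ∀ p, HasPD (fun q => X q 0) 0 p (2 * ψ * p 0) := fun p => by
    have h := ((HasPD.time p).mul (HasPD.time p)).const_mul ψ
    rwa [show ψ * (1 * p 0 + p 0 * 1) = 2 * ψ * p 0 by ring] at h
  have hηt : ∀ p ∈ productDomain I U, ∀ i : Fin n,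
      pd (fun q => X q i.succ) 0 p = Y (spacePart p) i := fun p hp i => by
    have h := ((HasPD.time p).mul (hY0 p hp i)).eq
    rwa [one_mul, mul_zero, add_zero] at h
  have hξ00 : ∀ p ∈ productDomain I U, ∀ a, pd (pd (fun q => X q 0) 0) a p
      = pd (fun q => 2 * ψ * q 0) a p := fun p hp a =>
    pd_congr hM (fun q _ => (hξ0 q).eq) a hp
  have hP : IsProjectiveWith (productDomain I U) (productMetric ε g) X
      (fun _ => point ψ fun _ => 0) := by
    refine isProjectiveWith_of_components hI hU hg hε hX
      (isVectorField_point contDiffOn_const fun _ => contDiffOn_const) (fun p hp => ?_)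
      (fun p hp j => ?_) (fun p hp i j => ?_) (fun p hp i => ?_) (fun p hp i j => ?_)
      (fun p hp i j k => ?_)
    · rw [hξ00 p hp, ((HasPD.time p).const_mul (2 * ψ)).eq, mul_one]
      rfl
    · rw [hξ00 p hp, ((HasPD.time_succ p j).const_mul (2 * ψ)).eq, mul_zero]
      rfl
    · simp [hXdef, hessian, pd_const]
    · rw [pd_congr hM (fun q hq => hηt q hq i) 0 hp]
      exact (hY0 p hp i).eq
    · have h1 : ∀ x ∈ U, spaceField (timeDeriv X) (p 0) x = Y x := fun x hx =>
        funext fun i => hηt (point (p 0) x) (point_mem hp.1 hx) i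
      exact (covDeriv_congr hU h1 hp.2 i j).trans (covDeriv_of_gradient hU hg hYv hYg hl hp.2 i j)
    · have h1 : spaceField X (p 0) = p 0 • Y := rfl
      have hpU : spacePart p ∈ U := hp.2
      rw [h1, lieConnection_smul hU hYv _ hpU, lieConnection_of_lieMetric hU hg hYv hl hpU]
      simp
  -- The `tt` component would force `2 ψ t = c` for all `t ∈ I`. Allowing every `c` excludes
  -- homothetic and Killing vectors together.
  have hlm : ∀ c : ℝ, ¬ ∀ x ∈ productDomain I U, ∀ i j,
      lieMetric (productMetric ε g) X i j x = 2 * c * productMetric ε g x i j := by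
    intro c h
    obtain ⟨s, hs, t, ht, hst⟩ := (infinite_of_mem_nhds t₀ (hI.mem_nhds ht₀)).nontrivial
    have h1 : ∀ r ∈ I, 2 * ψ * r = c := by
      intro r hr
      have h2 := h (point r x₀) (point_mem hr hx₀) 0 0
      rw [lieMetric_product_zero_zero, (hξ0 _).eq, productMetric_zero_zero, point_zero] at h2
      refine mul_left_cancel₀ (mul_ne_zero two_ne_zero hε) ?_
      linarith
    exact hst (mul_left_cancel₀ (mul_ne_zero two_ne_zero hψ) ((h1 s hs).trans (h1 t ht).symm))
  refine ⟨X, isProjective_iff.2 ⟨_, hP⟩, fun hA => ?_, fun hH => ?_, fun hK => ?_⟩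
  · have h1 := hA.2 (point t₀ x₀) (point_mem ht₀ hx₀) 0 0 0
    rw [hP.2.2 _ (point_mem ht₀ hx₀)] at h1
    simp only [if_true, point_zero] at h1
    exact hψ (by linarith)
  · obtain ⟨_, c, _, h⟩ := hH
    exact hlm c h
  · exact hlm 0 fun x hx i j => by
      rw [hK.2 x hx]
      ring

/-- For `w_0 = c ≠ 0` the slice of `∂_t X` is the required vector. For `c = 0` it has to be produced
from the spatial part of the one-form, which is where the non-degeneracy of the gradient Killing
vectors enters. -/
theorem exists_homothetic_of_properProjective (hn : 1 ≤ n) (hI : IsOpen I) (hIc : IsConnected I)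
    (hU : IsOpen U) (hUc : IsConnected U) (hg : IsMetricOn U g) (hε : ε ≠ 0)
    (hN : NondegGradientKilling U g) {X : (Fin (n + 1) → ℝ) → Fin (n + 1) → ℝ}
    (hX : IsProperProjective (productDomain I U) (productMetric ε g) X) :
    ∃ Y, IsHomothetic U g Y ∧ IsGradient U g Y := by
  have hM := isOpen_productDomain hI hU
  obtain ⟨hXp, hA, -, -⟩ := hX
  obtain ⟨w, h⟩ := isProjective_iff.1 hXp
  obtain ⟨c, hc⟩ := h.exists_const hn hI hIc hU hUc hg hε
  by_cases hc0 : c = 0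
  · obtain ⟨p, hp, a, ha⟩ : ∃ p ∈ productDomain I U, ∃ a, w p a ≠ 0 := by
      by_contra! hw
      exact hA ⟨h.1, fun x hx i j k => by simp [h.2.2 x hx, hw x hx]⟩
    obtain ⟨j, rfl⟩ : ∃ j : Fin n, a = j.succ := by
      refine Fin.eq_succ_of_ne_zero fun h0 => ha ?_
      rw [h0, hc p hp, hc0]
    have hpU : spacePart p ∈ U := hp.2
    have hσM := isVectorField_timeDeriv hI hU h.1 0
    -- On this slice `σ_{,i} = w_i`, so `σ` is the projective function of the slice of `X`, and its
    -- differential is non-zero at the chosen point.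
    set σ : (Fin n → ℝ) → ℝ := fun x => timeDeriv X (point (p 0) x) 0 with hσdef
    have hσ : ContDiffOn ℝ ∞ σ U := smooth_slice hσM hp.1
    have hσw : ∀ x ∈ U, ∀ i, pd σ i x = w (point (p 0) x) i.succ := fun x hx i => by
      have hx' := point_mem hp.1 hx
      have h1 := pd_slice (HasPD.of_smooth hM hσM i.succ hx')
      rw [point_zero, spacePart_point] at h1
      exact h1.trans (h.time_space hI hU hg hε hx' i)
    have hh : ∀ x ∈ U, ∀ i k, hessian g σ i k x = 0 := fun x hx i k =>
      (h.timeDeriv hI hU hg hε).hessian_time hI hU hg hε (point_mem hp.1 hx) i k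
    obtain ⟨hK, hG⟩ := killing_gradient_of_hessian hU hg hσ hh
    have hL : ∀ x ∈ U, ∀ i j k, lieConnection g (spaceField X (p 0)) i j k x
        = (if i = k then pd σ j x else 0) + (if i = j then pd σ k x else 0) := by
      intro x hx i j k
      rw [hσw x hx, hσw x hx]
      exact h.lieConnection_spaceField hI hU hg hε (point_mem hp.1 hx) i j k
    by_contra hno
    -- Without a gradient homothetic vector, the gradient of `σ` is orthogonal to every gradient
    -- Killing vector, so the proviso makes it vanish, contradicting `ha`.
    have hY0 := hN _ hK hG fun Z hZ hZg x hx => by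
      by_contra hne
      refine hno (exists_homothetic_gradient hU hUc hg (isVectorField_spaceField h.1 hp.1) hσ hL hh
        hZ hZg hx fun h0 => hne ?_)
      rw [Finset.sum_comm, ← h0]
      refine Finset.sum_congr rfl fun k _ => ?_
      rw [← Finset.sum_mul, ← lower_raise hg (fun l => pd σ l) hx k, lower]
      congr 1
      refine Finset.sum_congr rfl fun i _ => ?_
      rw [hg.apply_comm hx i k]
    refine ha ?_
    have h1 := hσw (spacePart p) hpU j
    rw [point_spacePart] at h1
    rw [← h1, ← lower_raise hg (fun l => pd σ l) hpU j, lower]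
    refine Finset.sum_eq_zero fun k _ => ?_
    have h2 := congrFun (hY0 _ hpU) k
    exact mul_eq_zero_of_right _ h2
  · obtain ⟨t, ht⟩ := hIc.nonempty
    exact ⟨_, homothetic_gradient_of_covDeriv hU hg
      (isVectorField_spaceField (isVectorField_timeDeriv hI hU h.1) ht) hc0 fun x hx i k => by
        rw [← hc (point t x) (point_mem ht hx)]
        exact h.covDeriv_timeDeriv hI hU hg hε (point_mem ht hx) i k⟩

/-- The mixed Killing equation reads `ε ∂_i ξ + g_{ij} ∂_t X^j = 0`, so the slice of `∂_t X` has
potential `-ε ξ`; it is Killing because `∂_t` commutes with `L_X g`. Conversely, a gradient Killing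
vector `Y` with potential `S` gives the rotation `S ∂_t - ε t Y`. -/
theorem rotation_iff (hI : IsOpen I) (hIn : I.Nonempty) (hU : IsOpen U) (hg : IsMetricOn U g)
    (hε : ε ≠ 0) (i : Fin n) :
    (∃ X, IsRotation I U ε g i X) ↔ ∃ Y, IsKilling U g Y ∧ IsGradient U g Y ∧
      (∀ x ∈ U, ∀ j, j ≠ i → Y x j = 0) ∧ ∃ x ∈ U, Y x ≠ 0 := by
  have hM := isOpen_productDomain hI hU
  constructor
  · rintro ⟨X, ⟨hX, hK⟩, hj, p, hp, hne⟩
    have hX' := isVectorField_timeDeriv hI hU hX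
    refine ⟨spaceField (timeDeriv X) (p 0), ⟨isVectorField_spaceField hX' hp.1,
      fun x hx a b => ?_⟩, ⟨fun x => -ε * X (point (p 0) x) 0,
        contDiffOn_const.mul (smooth_slice (hX 0) hp.1), fun x hx a => ?_⟩,
      fun x hx j hji => ?_, spacePart p, hp.2, fun h0 => hne ?_⟩
    · have hx' := point_mem hp.1 hx
      have h1 := lieMetric_timeDeriv hI hU hg hε hX hx' a.succ b.succ
      rw [lieMetric_product_succ_succ hI hU hg hX' hx',
        pd_congr hM (fun q hq => hK q hq a.succ b.succ) 0 hx', pd_const] at h1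
      exact h1
    · have hx' := point_mem hp.1 hx
      have h1 := hK _ hx' a.succ 0
      rw [lieMetric_product_succ_zero] at h1
      have h2 := pd_slice (HasPD.of_smooth hM (hX 0) a.succ hx')
      rw [point_zero, spacePart_point] at h2
      have h3 := ((HasPD.of_smooth hU (smooth_slice (hX 0) hp.1) a hx).const_mul (-ε)).eq
      rw [h3, h2]
      change ∑ k, g x a k * pd (fun q => X q k.succ) 0 (point (p 0) x) = _
      rw [spacePart_point] at h1
      linarith
    · have hx' := point_mem hp.1 hx
      change pd (fun q => X q j.succ) 0 (point (p 0) x) = 0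
      rw [pd_congr hM (fun q hq => hj q hq j hji) 0 hx', pd_const]
    · have h1 := congrFun h0 i
      rwa [spaceField_spacePart] at h1
  · rintro ⟨Y, ⟨hY, hK⟩, ⟨S, hS, hYS⟩, hj, x₀, hx₀, hne⟩
    obtain ⟨t₀, ht₀⟩ := hIn
    set X : (Fin (n + 1) → ℝ) → Fin (n + 1) → ℝ := fun p =>
      point (S (spacePart p)) (fun k => -ε * p 0 * Y (spacePart p) k) with hXdef
    have hX : IsVectorField (productDomain I U) X :=
      isVectorField_point (smooth_spacePart hS) fun k =>
        (contDiffOn_const.mul smooth_time).mul (smooth_spacePart (hY k))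
    have hη : ∀ p ∈ productDomain I U, ∀ k : Fin n,
        pd (fun q => X q k.succ) 0 p = -ε * Y (spacePart p) k := fun p hp k => by
      have h := (((HasPD.time p).const_mul (-ε)).mul
        (HasPD.comp_spacePart_zero (HasPD.of_smooth hU (hY k) k hp.2).1)).eq
      rwa [mul_one, mul_zero, add_zero] at h
    have hξ : ∀ p ∈ productDomain I U, ∀ k : Fin n,
        pd (fun q => X q 0) k.succ p = ∑ l, g (spacePart p) k l * Y (spacePart p) l :=
      fun p hp k => ((HasPD.of_smooth hU hS k hp.2).comp_spacePart.eq).trans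
        (hYS (spacePart p) hp.2 k).symm
    have hmix : ∀ p ∈ productDomain I U, ∀ k : Fin n,
        lieMetric (productMetric ε g) X k.succ 0 p = 0 := fun p hp k => by
      rw [lieMetric_product_succ_zero, hξ p hp, Finset.mul_sum, ← Finset.sum_add_distrib]
      refine Finset.sum_eq_zero fun l _ => ?_
      rw [hη p hp]
      ring
    refine ⟨X, ⟨hX, fun p hp a b => ?_⟩, fun p hp j hji => ?_, point t₀ x₀, point_mem ht₀ hx₀, ?_⟩
    · refine Fin.cases ?_ (fun j => ?_) a <;> refine Fin.cases ?_ (fun k => ?_) b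
      · rw [lieMetric_product_zero_zero]
        have h1 : pd (fun q => X q 0) 0 p = 0 := (HasPD.comp_spacePart_zero
          (HasPD.of_smooth hU hS i hp.2).1).eq
        rw [h1, mul_zero]
      · rw [lieMetric_comm hM (isMetricOn_product hg hε) X hp, hmix p hp]
      · exact hmix p hp j
      · have h1 : spaceField X (p 0) = (-ε * p 0) • Y := rfl
        have hpU : spacePart p ∈ U := hp.2
        rw [lieMetric_product_succ_succ hI hU hg hX hp, h1, lieMetric_smul hU hY _ hpU, hK _ hpU,
          mul_zero]
    · have h1 : Y (spacePart p) j = 0 := hj _ hp.2 j hji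
      simp [hXdef, h1]
    · rw [hη _ (point_mem ht₀ hx₀), spacePart_point]
      -- The only component of `Y` that can be non-zero is the `i`-th, so it is non-zero at `x₀`.
      refine mul_ne_zero (neg_ne_zero.2 hε) fun h0 => hne (funext fun k => ?_)
      by_cases hk : k = i
      · rw [hk, h0, Pi.zero_apply]
      · exact hj x₀ hx₀ k hk

/-! ### Lifts of special collineations and the dimension of the projective algebra -/

/-- A special projective collineation of the `n`-space lifts to the decomposable space. -/
theorem isProjective_lift (hI : IsOpen I) (hU : IsOpen U) (hg : IsMetricOn U g) (hε : ε ≠ 0)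
    {Y : (Fin n → ℝ) → Fin n → ℝ} (hY : IsVectorField U Y) {φ : (Fin n → ℝ) → ℝ}
    (hφ : ContDiffOn ℝ ∞ φ U)
    (hL : ∀ x ∈ U, ∀ i j k, lieConnection g Y i j k x
      = (if i = k then pd φ j x else 0) + (if i = j then pd φ k x else 0))
    (hh : ∀ x ∈ U, ∀ i j, hessian g φ i j x = 0) (c : ℝ) :
    IsProjective (productDomain I U) (productMetric ε g)
      (fun p => point (c + p 0 * φ (spacePart p)) (Y (spacePart p))) := by
  have hM := isOpen_productDomain hI hU
  set X : (Fin (n + 1) → ℝ) → Fin (n + 1) → ℝ := fun p =>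
    point (c + p 0 * φ (spacePart p)) (Y (spacePart p)) with hXdef
  have hX : IsVectorField (productDomain I U) X :=
    isVectorField_point (contDiffOn_const.add (smooth_time.mul (smooth_spacePart hφ)))
      fun k => smooth_spacePart (hY k)
  have hφ0 : ∀ p ∈ productDomain I U, HasPD (fun q => φ (spacePart q)) 0 p 0 := fun p hp =>
    HasPD.comp_spacePart_zero (hφ.contDiffAt (hU.mem_nhds hp.2) |>.differentiableAt (by simp))
  have hξ : ∀ p ∈ productDomain I U, pd (fun q => X q 0) 0 p = φ (spacePart p) := fun p hp => by
    have h := ((HasPD.const c 0 p).add ((HasPD.time p).mul (hφ0 p hp))).eq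
    rwa [one_mul, mul_zero, add_zero, zero_add] at h
  have hη : ∀ p ∈ productDomain I U, ∀ k : Fin n, pd (fun q => X q k.succ) 0 p = 0 :=
    fun p hp k => (HasPD.comp_spacePart_zero (HasPD.of_smooth hU (hY k) k hp.2).1).eq
  -- The one-form is `dφ`, without time component. The equation `∂_j ∂_t ξ = φ_{,j}` explains the
  -- time component `t φ` of the lift, and `φ_{;ij} = 0` gives the Hessian equation for it.
  refine isProjective_iff.2 ⟨fun p => point 0 fun j => pd φ j (spacePart p),
    isProjectiveWith_of_components hI hU hg hε hX
      (isVectorField_point contDiffOn_const fun j => smooth_spacePart (pd_smooth hU hφ j))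
      (fun p hp => ?_) (fun p hp j => ?_) (fun p hp i j => ?_) (fun p hp i => ?_)
      (fun p hp i j => ?_) (fun p hp i j k => ?_)⟩
  · rw [pd_congr hM hξ 0 hp, (hφ0 p hp).eq, point_zero, mul_zero]
  · rw [pd_congr hM hξ j.succ hp]
    exact (HasPD.of_smooth hU hφ j hp.2).comp_spacePart.eq
  · have hpU : spacePart p ∈ U := hp.2
    have h1 := hessian_const_mul (g := g) hU hφ (p 0) c hpU i j
    rw [hh _ hpU, mul_zero] at h1
    exact h1
  · rw [pd_congr hM (fun q hq => hη q hq i) 0 hp, pd_const]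
  · have h1 : ∀ x ∈ U, spaceField (timeDeriv X) (p 0) x = (0 : (Fin n → ℝ) → Fin n → ℝ) x :=
      fun x hx => funext fun i => hη (point (p 0) x) (point_mem hp.1 hx) i
    refine (covDeriv_congr hU h1 hp.2 i j).trans ?_
    simp [covDeriv, pd_const]
  · exact hL _ hp.2 i j k

/-- The element of the projective algebra given by a projective collineation. -/
noncomputable def toProjectiveAlgebra {m : ℕ} {U : Set (Fin m → ℝ)} (hU : IsOpen U)
    {g : (Fin m → ℝ) → Matrix (Fin m) (Fin m) ℝ} {X : (Fin m → ℝ) → Fin m → ℝ}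
    (hX : IsProjective U g X) : projectiveAlgebra U hU g :=
  ⟨U.indicator X, isProjective_congr hU (fun _ hx => Set.indicator_of_mem hx X) hX,
    fun _ hx => Set.indicator_of_notMem hx X⟩

theorem toProjectiveAlgebra_apply {m : ℕ} {U : Set (Fin m → ℝ)} (hU : IsOpen U)
    {g : (Fin m → ℝ) → Matrix (Fin m) (Fin m) ℝ} {X : (Fin m → ℝ) → Fin m → ℝ}
    (hX : IsProjective U g X) {x : Fin m → ℝ} (hx : x ∈ U) :
    (toProjectiveAlgebra hU hX : (Fin m → ℝ) → Fin m → ℝ) x = X x :=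
  Set.indicator_of_mem hx X

/-- The projective function of the zero field is an arbitrary constant. This freedom is invisible on
the `n`-space, but its lift is a multiple of `t ∂_t`. -/
theorem special_zero_const (c : ℝ) :
    (∀ x ∈ U, ∀ i j k, lieConnection g 0 i j k x
      = (if i = k then pd (fun _ => c) j x else 0) + (if i = j then pd (fun _ => c) k x else 0)) ∧
    ∀ x ∈ U, ∀ i j, hessian g (fun _ => c) i j x = 0 := by
  refine ⟨fun x _ i j k => by simp [lieConnection_zero, pd_const], fun x _ i j => ?_⟩
  simp [hessian, pd_const]

/-- The fields `∂_t` and `t ∂_t` are projective collineations. -/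
theorem isProjective_time (hI : IsOpen I) (hU : IsOpen U) (hg : IsMetricOn U g) (hε : ε ≠ 0)
    (c d : ℝ) : IsProjective (productDomain I U) (productMetric ε g)
      (fun p => point (c + p 0 * d) 0) :=
  isProjective_lift hI hU hg hε (Y := 0) (φ := fun _ => d) (fun _ => contDiffOn_const)
    contDiffOn_const (special_zero_const d).1 (special_zero_const d).2 c

theorem two_le_rank_projectiveAlgebra (hI : IsOpen I) (hIn : I.Nonempty) (hU : IsOpen U)
    (hUn : U.Nonempty) (hg : IsMetricOn U g) (hε : ε ≠ 0) :
    2 ≤ Module.rank ℝ (projectiveAlgebra (productDomain I U) (isOpen_productDomain hI hU)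
      (productMetric ε g)) := by
  have hM := isOpen_productDomain hI hU
  obtain ⟨t₀, ht₀⟩ := hIn
  obtain ⟨x₀, hx₀⟩ := hUn
  have hli : LinearIndependent ℝ
      ![toProjectiveAlgebra hM (isProjective_time hI hU hg hε 1 0),
        toProjectiveAlgebra hM (isProjective_time hI hU hg hε 0 1)] := by
    refine LinearIndependent.pair_iff.2 fun a b hab => ?_
    have h1 : ∀ t ∈ I, a + b * t = 0 := by
      intro t ht
      have h2 := congrFun (congrFun (congrArg Subtype.val hab) (point t x₀)) 0
      simpa [toProjectiveAlgebra_apply hM _ (point_mem ht hx₀)] using h2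
    -- An affine function of `t` that vanishes at two distinct points of `I` is zero.
    obtain ⟨s, hs, t, ht, hst⟩ := (infinite_of_mem_nhds t₀ (hI.mem_nhds ht₀)).nontrivial
    have hb : b = 0 := by
      refine (mul_eq_zero.1 (?_ : b * (s - t) = 0)).resolve_right (sub_ne_zero.2 hst)
      linear_combination h1 s hs - h1 t ht
    refine ⟨?_, hb⟩
    simpa [hb] using h1 s hs
  simpa using hli.cardinal_le_rank

/-- The lift of `Y` is independent of `∂_t` and `t ∂_t` because it alone has a spatial part, which
is non-zero over `x₀`. -/
theorem three_le_rank_projectiveAlgebra (hI : IsOpen I) (hIn : I.Nonempty) (hU : IsOpen U)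
    (hg : IsMetricOn U g) (hε : ε ≠ 0) {Y : (Fin n → ℝ) → Fin n → ℝ}
    (hY : IsSpecialProjective U g Y) {x₀ : Fin n → ℝ} (hx₀ : x₀ ∈ U) (hne : Y x₀ ≠ 0) :
    3 ≤ Module.rank ℝ (projectiveAlgebra (productDomain I U) (isOpen_productDomain hI hU)
      (productMetric ε g)) := by
  have hM := isOpen_productDomain hI hU
  obtain ⟨t₀, ht₀⟩ := hIn
  obtain ⟨hYv, φ, hφ, hL, hh⟩ := hY
  have hli : LinearIndependent ℝ
      ![toProjectiveAlgebra hM (isProjective_time hI hU hg hε 1 0),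
        toProjectiveAlgebra hM (isProjective_time hI hU hg hε 0 1),
        toProjectiveAlgebra hM (isProjective_lift hI hU hg hε hYv hφ hL hh 0)] := by
    refine Fintype.linearIndependent_iff.2 fun c hc => ?_
    rw [Fin.sum_univ_three] at hc
    have hc' : ∀ t ∈ I, ∀ a, c 0 * point (1 + t * 0) (0 : Fin n → ℝ) a
        + c 1 * point (0 + t * 1) (0 : Fin n → ℝ) a
        + c 2 * point (0 + t * φ x₀) (Y x₀) a = 0 := by
      intro t ht a
      have h2 := congrFun (congrFun (congrArg Subtype.val hc) (point t x₀)) a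
      simpa [toProjectiveAlgebra_apply hM _ (point_mem ht hx₀)] using h2
    obtain ⟨i, hi⟩ := Function.ne_iff.1 hne
    have h2 : c 2 = 0 := by
      have h := hc' t₀ ht₀ i.succ
      simp only [point_succ, Pi.zero_apply, mul_zero, zero_add] at h
      exact (mul_eq_zero.1 h).resolve_right hi
    have h01 : ∀ t ∈ I, c 0 + c 1 * t = 0 := fun t ht => by simpa [h2] using hc' t ht 0
    obtain ⟨s, hs, t, ht, hst⟩ := (infinite_of_mem_nhds t₀ (hI.mem_nhds ht₀)).nontrivial
    have h1 : c 1 = 0 := by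
      refine (mul_eq_zero.1 (?_ : c 1 * (s - t) = 0)).resolve_right (sub_ne_zero.2 hst)
      linear_combination h01 s hs - h01 t ht
    have h0 : c 0 = 0 := by simpa [h1] using h01 s hs
    intro k
    fin_cases k
    · exact h0
    · exact h1
    · exact h2
  simpa using hli.cardinal_le_rank

end Results

end DecomposableSpace

theorem theorem5 {n : ℕ} (hn : 1 ≤ n) {I : Set ℝ} (hIo : IsOpen I) (hI : IsConnected I)
    {U : Set (Fin n → ℝ)} (hUo : IsOpen U) (hU : IsConnected U)
    {g : (Fin n → ℝ) → Matrix (Fin n) (Fin n) ℝ} (hg : DecomposableSpace.IsMetricOn U g)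
    {ε : ℝ} (hε : ε ≠ 0) :
    -- (A)
    (∀ X, DecomposableSpace.IsProperProjective (DecomposableSpace.productDomain I U)
        (DecomposableSpace.productMetric ε g) X →
      DecomposableSpace.IsSpecialProjective (DecomposableSpace.productDomain I U)
        (DecomposableSpace.productMetric ε g) X) ∧
    -- (B)
    ((∃ X, DecomposableSpace.IsHomothetic (DecomposableSpace.productDomain I U)
        (DecomposableSpace.productMetric ε g) X) ↔
      ∃ Y, DecomposableSpace.IsHomothetic U g Y) ∧
    -- (C), sufficiency
    ((∃ Y, DecomposableSpace.IsHomothetic U g Y ∧ DecomposableSpace.IsGradient U g Y) →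
      ∃ X, DecomposableSpace.IsProperProjective (DecomposableSpace.productDomain I U)
        (DecomposableSpace.productMetric ε g) X) ∧
    -- (C), necessity; the condition on the gradient Killing vectors is automatic if g is definite
    (DecomposableSpace.NondegGradientKilling U g →
      (∃ X, DecomposableSpace.IsProperProjective (DecomposableSpace.productDomain I U)
        (DecomposableSpace.productMetric ε g) X) →
      ∃ Y, DecomposableSpace.IsHomothetic U g Y ∧ DecomposableSpace.IsGradient U g Y) ∧
    -- (D)
    (∀ i : Fin n, (∃ X, DecomposableSpace.IsRotation I U ε g i X) ↔
      ∃ Y, DecomposableSpace.IsKilling U g Y ∧ DecomposableSpace.IsGradient U g Y ∧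
        (∀ x ∈ U, ∀ j, j ≠ i → Y x j = 0) ∧ ∃ x ∈ U, Y x ≠ 0) ∧
    -- (E)
    2 ≤ Module.rank ℝ (DecomposableSpace.projectiveAlgebra (DecomposableSpace.productDomain I U)
        (DecomposableSpace.isOpen_productDomain hIo hUo) (DecomposableSpace.productMetric ε g)) ∧
    (Module.rank ℝ (DecomposableSpace.projectiveAlgebra (DecomposableSpace.productDomain I U)
        (DecomposableSpace.isOpen_productDomain hIo hUo) (DecomposableSpace.productMetric ε g)) = 2 →
      ∀ Y, DecomposableSpace.IsSpecialProjective U g Y → ∀ x ∈ U, Y x = 0) := by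
  refine ⟨fun X hX => ?_, DecomposableSpace.homothetic_product_iff hIo hI.nonempty hUo hg,
    fun ⟨Y, hY, hYg⟩ => DecomposableSpace.exists_properProjective hIo hI.nonempty hUo hU.nonempty hg
      hε hY hYg,
    fun hN ⟨X, hX⟩ => DecomposableSpace.exists_homothetic_of_properProjective hn hIo hI hUo hU hg hε
      hN hX,
    DecomposableSpace.rotation_iff hIo hI.nonempty hUo hg hε,
    DecomposableSpace.two_le_rank_projectiveAlgebra hIo hI.nonempty hUo hU.nonempty hg hε,
    fun h2 Y hY x hx => ?_⟩
  · obtain ⟨w, h⟩ := DecomposableSpace.isProjective_iff.1 hX.1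
    exact h.isSpecialProjective hn hIo hI hUo hU hg hε
  · by_contra hne
    have h3 := DecomposableSpace.three_le_rank_projectiveAlgebra hIo hI.nonempty hUo hg hε hY hx hne
    rw [h2] at h3
    exact absurd h3 (by norm_num)
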